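/- Let $d=2$ and $q\ge 3$ odd, or $d=3$ and $q\in\{3,5\}$. Let $L,T>0$ and $D=(0,L)^d$; write $(\cdot,\cdot)$ for the inner product of $L^2=L^2(D)$. Let $c,M\ge 0$. Then there is a constant $C$, depending only on $d,q,L,T,c,M$, such that the following holds. **Noise.** Let $(\Omega,\mathcal F,(\mathcal F_t)_{t\ge0},\mathbb P)$ be a filtered probability space and $W$ a real-valued Wiener process with respect to $(\mathcal F_t)$. Let $G:L^2\to L^2$ be twice Gateaux differentiable and satisfy, for all $u,v,w\in L^2$, * (A1) $\|G(v)-G(w)\|_{L^2}\le c\|v-w\|_{L^2}$ and $\|G(v)\|_{L^2}\le c(\|v\|_{L^2}+1)$; * (A2) $\sup_{v}\|DG(v)\|_{\mathcal L(L^2,L^2)}+\sup_{v}\|D^2G(v)\|_{\mathcal L(L^2,\mathcal L(L^2,L^2))}\le c$; * (A3) $\|(DG(u)-DG(v))G(v)\|_{L^2}\le c\|u-v\|_{L^2}$. Let $u_0$ be an $\mathcal F_0$-measurable $L^2$-valued random variable with $\mathbb E\|u_0\|_{L^2}^2\le M$. **Mesh.** Let $\mathcal T_h$ be a (finite, conforming)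 simplicial triangulation of $\overline D$ such that, for each edge $E$ of $\mathcal T_h$ not contained in $\partial D$, $$\frac1{d(d-1)}\sum_{K\supset E}|\kappa_E^K|\cot\theta_E^K\ge 0 ,$$ where $K$ runs over the $d$-simplices of $\mathcal T_h$ containing $E$ and, for $E$ the edge joining the vertices $a_i,a_j$ of $K$ and $F_i$ the face of $K$ opposite to $a_i$, $\kappa_E^K=F_i\cap F_j$, $|\kappa_E^K|$ is its $(d-2)$-dimensional volume ($1$ if $d=2$) and $\theta_E^K$ is the angle between $F_i$ and $F_j$. Let $V_h$ be the space of functions in $H^1_0(D)$ that are affine on each $d$-simplex of $\mathcal T_h$ (equivalently, the continuous functions on $\overline D$ that are affine on each $d$-simplex and vanish on $\partial D$), and let $I_hf=\sum_a f(a)\varphi_a$ be nodal interpolation, where $a$ runs over the vertices of $\mathcal T_h$ and $\varphi_a$ is the hat function of $a$. **Scheme.** Let $N\ge1$, $\tau=T/N$, $t_n=n\tau$, $\Delta W_n=W(t_{n+1})-W(t_n)$. Let $u_h^0,\dots,u_h^N$ be $V_h$-valued, $u_h^n$ measurable with respect to $\mathcal F_{t_n}$, such that $\mathbb P$-almost surely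 $(u_h^0,v_h)=(u_0,v_h)$ for all $v_h\in V_h$, and, for $0\le n<N$ and all $v_h\in V_h$, $$(u_h^{n+1}-u_h^n,v_h)+\tau(\nabla u_h^{n+1},\nabla v_h)=\tau\bigl(I_h[u_h^{n+1}-(u_h^{n+1})^q],v_h\bigr)+(G(u_h^n),v_h)\,\Delta W_n+\tfrac12\bigl(DG(u_h^n)G(u_h^n),v_h\bigr)\bigl[(\Delta W_n)^2-\tau\bigr].$$ **Conclusion.** $$\sup_{0\le n\le N}\mathbb E\|u_h^n\|_{L^2}^2+\sum_{n=0}^{N-1}\mathbb E\|u_h^{n+1}-u_h^n\|_{L^2}^2+\tau\sum_{n=0}^{N-1}\mathbb E\|\nabla u_h^{n+1}\|_{L^2}^2+\frac\tau2\sum_{n=0}^{N-1}\mathbb E\|u_h^{n+1}\|_{L^{q+1}}^{q+1}\le C .$$ -/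

import Mathlib

open MeasureTheory ProbabilityTheory Set
open scoped NNReal ENNReal RealInnerProductSpace

noncomputable section

namespace StochFEM

/-- Euclidean space of dimension `d`. -/
abbrev E (d : ℕ) : Type := EuclideanSpace ℝ (Fin d)

/-- The open cube `D = (0, L)^d`. -/
def cube (d : ℕ) (L : ℝ) : Set (E d) := {x | ∀ i, x i ∈ Ioo 0 L}

/-- The real Hilbert space `L²(D)`, `D = (0, L)^d`. -/
abbrev L2 (d : ℕ) (L : ℝ) : Type := Lp ℝ 2 (volume.restrict (cube d L))

/-- The integral `∫_D f g dx`. -/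
def ip {d : ℕ} (L : ℝ) (f g : E d → ℝ) : ℝ := ∫ x in cube d L, f x * g x

/-- The integral `∫_D ∇f · ∇g dx`. -/
def gip {d : ℕ} (L : ℝ) (f g : E d → ℝ) : ℝ := ∫ x in cube d L, ⟪gradient f x, gradient g x⟫

/-! ### Assumptions on the diffusion coefficient -/

/-- `DG` is the Gateaux derivative of `G`: for all `u`, `v`, the directional derivative of `G` at
`u` in direction `v` exists and equals `DG u v`, where `DG u` is a bounded linear map. -/
def IsGateauxDeriv {H K : Type*} [NormedAddCommGroup H] [NormedSpace ℝ H] [NormedAddCommGroup K]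
    [NormedSpace ℝ K] (G : H → K) (DG : H → H →L[ℝ] K) : Prop :=
  ∀ u v : H, HasLineDerivAt ℝ G (DG u v) u v

/-- The assumptions (A1), (A2), (A3) with constant `c` on a map `G` of a Hilbert space `H` into
itself, with Gateaux derivative `DG`. -/
structure NoiseAssumptions {H : Type*} [NormedAddCommGroup H] [InnerProductSpace ℝ H]
    (G : H → H) (DG : H → H →L[ℝ] H) (c : ℝ) : Prop where
  /-- `DG` is the first Gateaux derivative of `G`. -/
  gateaux : IsGateauxDeriv G DG
  /-- (A1), global Lipschitz continuity. -/
  lipschitz : ∀ v w, ‖G v - G w‖ ≤ c * ‖v - w‖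
  /-- (A1), linear growth. -/
  growth : ∀ v, ‖G v‖ ≤ c * (‖v‖ + 1)
  /-- (A2), the first two Gateaux derivatives are bounded, `sup ‖DG‖ + sup ‖D²G‖ ≤ c`. -/
  deriv_bound : ∃ D2G : H → H →L[ℝ] H →L[ℝ] H, IsGateauxDeriv DG D2G ∧
    ∀ u w, ‖DG u‖ + ‖D2G w‖ ≤ c
  /-- (A3). -/
  milstein : ∀ u v, ‖(DG u - DG v) (G v)‖ ≤ c * ‖u - v‖

/-! ### Triangulations -/

/-- A (conforming) triangulation of the closed cube: a finite simplicial complex whose underlying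
space is the closure of `(0, L)^d`. A simplex is given by the finite set of its vertices. -/
structure Triangulation (d : ℕ) (L : ℝ) where
  /-- The underlying simplicial complex. -/
  complex : Geometry.SimplicialComplex ℝ (E d)
  /-- There are finitely many simplices. -/
  finite : complex.faces.Finite
  /-- The simplices cover exactly the closed cube. -/
  space_eq : complex.space = closure (cube d L)

namespace Triangulation

variable {d : ℕ} {L : ℝ} (𝒯 : Triangulation d L)

/-- The `d`-dimensional simplices `K` of the triangulation. -/
def cells : Finset (Finset (E d)) := 𝒯.finite.toFinset.filter (fun s => s.card = d + 1)

open Classical in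
/-- The vertices of the triangulation. -/
def vertices : Finset (E d) := 𝒯.finite.toFinset.biUnion id

/-- `w` is the system of barycentric coordinates of `x` in the simplex with vertex set `s`, extended
by zero to points that are not vertices of `s`. -/
def _root_.StochFEM.IsBarycentric {d : ℕ} (s : Finset (E d)) (x : E d) (w : E d → ℝ) : Prop :=
  (∀ y ∈ s, 0 ≤ w y) ∧ (∀ y ∉ s, w y = 0) ∧ ∑ y ∈ s, w y = 1 ∧ ∑ y ∈ s, w y • y = x

open Classical in
/-- The nodal basis (hat) function `φ_a` of the vertex `a`: at a point `x` of the closed cube it is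
the barycentric coordinate of `x` with respect to `a` in any simplex of the triangulation that
contains `x` (the coordinates do not depend on that simplex); it is zero outside the closed cube. -/
def hat (a x : E d) : ℝ :=
  if h : ∃ w : E d → ℝ, ∃ s ∈ 𝒯.complex.faces, IsBarycentric s x w then h.choose a else 0

/-- The nodal interpolation operator `I_h f = ∑_a f(a) φ_a`, summed over all vertices `a`. -/
def interp (f : E d → ℝ) (x : E d) : ℝ := ∑ a ∈ 𝒯.vertices, f a * 𝒯.hat a x

open Classical in
/-- The simplex `κ = F_a ∩ F_b` opposite to the edge `ab` in the simplex `s` (its vertex set); here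
`F_a` is the face of `s` opposite to the vertex `a`. -/
def _root_.StochFEM.oppFace {d : ℕ} (s : Finset (E d)) (a b : E d) : Finset (E d) := s \ {a, b}

/-- The angle between the faces `F_a` and `F_b` of the simplex `s`. Both contain the
`(d-2)`-dimensional simplex `κ = F_a ∩ F_b`; besides, `F_a` contains `b` and `F_b` contains `a`. So
it is the angle between the components orthogonal to `κ` of the vectors that lead from a point of
`κ` to `a` and to `b`. If `d = 2`, this is the angle of the triangle opposite to the edge `ab`. -/
def _root_.StochFEM.dihedralAngle {d : ℕ} (s : Finset (E d)) (a b : E d) : ℝ :=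
  let κ := oppFace s a b
  let U := vectorSpan ℝ (κ : Set (E d))
  let c := κ.centroid ℝ id
  InnerProductGeometry.angle (Uᗮ.starProjection (a - c)) (Uᗮ.starProjection (b - c))

open Classical in
/-- The mesh condition: for each edge `ab` of the triangulation that does not lie on the boundary
of the cube, `1 / (d (d - 1)) ∑_K |κ| cot θ ≥ 0`, where `K` runs over the `d`-simplices that contain
the edge and `|κ|` is the `(d-2)`-dimensional volume of `κ` (for `d = 2`, `κ` is a point and
`|κ| = 1`; for `d = 3`, `|κ|` is the length of the opposite edge). -/
def MeshCondition : Prop :=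
  ∀ a b : E d, a ≠ b → {a, b} ∈ 𝒯.complex.faces → ¬ segment ℝ a b ⊆ frontier (cube d L) →
    0 ≤ 1 / ((d : ℝ) * ((d : ℝ) - 1)) *
      ∑ K ∈ 𝒯.cells with a ∈ K ∧ b ∈ K,
        (μHE[d - 2]).real (convexHull ℝ (oppFace K a b : Set (E d))) *
          Real.cot (dihedralAngle K a b)

/-- The `P₁`-Lagrange finite element space with zero boundary values: continuous functions,
extended by zero outside `D`, whose restriction to every `d`-simplex `K` is affine. -/
def Vh : Submodule ℝ (E d → ℝ) where
  carrier := {v | Continuous v ∧ (∀ x ∉ cube d L, v x = 0) ∧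
    ∀ K ∈ 𝒯.cells, ∃ A : E d →ᵃ[ℝ] ℝ, EqOn v A (convexHull ℝ (K : Set (E d)))}
  zero_mem' := ⟨continuous_const, fun _ _ => rfl, fun _ _ => ⟨0, fun _ _ => rfl⟩⟩
  add_mem' := by
    rintro v w ⟨hv, hv0, hvA⟩ ⟨hw, hw0, hwA⟩
    refine ⟨hv.add hw, fun x hx => by simp [hv0 x hx, hw0 x hx], fun K hK => ?_⟩
    obtain ⟨A, hA⟩ := hvA K hK
    obtain ⟨B, hB⟩ := hwA K hK
    exact ⟨A + B, fun x hx => by simp [hA hx, hB hx]⟩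
  smul_mem' := by
    rintro r v ⟨hv, hv0, hvA⟩
    refine ⟨hv.const_smul r, fun x hx => by simp [hv0 x hx], fun K hK => ?_⟩
    obtain ⟨A, hA⟩ := hvA K hK
    exact ⟨r • A, fun x hx => by simp [hA hx]⟩

theorem cube_isBounded (d : ℕ) (L : ℝ) : Bornology.IsBounded (cube d L) := by
  have h : Bornology.IsBounded (Set.pi univ fun _ : Fin d => Icc (0 : ℝ) L) :=
    Bornology.IsBounded.pi fun _ => Metric.isBounded_Icc 0 L
  have h2 := (PiLp.lipschitzWith_toLp 2 (fun _ : Fin d => ℝ)).isBounded_image h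
  refine h2.subset fun x hx => ⟨WithLp.ofLp x, fun i _ => ⟨(hx i).1.le, (hx i).2.le⟩, rfl⟩

theorem Vh_memLp (v : 𝒯.Vh) : MemLp (v : E d → ℝ) 2 (volume.restrict (cube d L)) := by
  have hc : HasCompactSupport (v : E d → ℝ) :=
    HasCompactSupport.intro (cube_isBounded d L).isCompact_closure
      fun x hx => v.2.2.1 x fun h => hx (subset_closure h)
  exact (v.2.1.memLp_of_hasCompactSupport hc).restrict _

/-- The inclusion of the finite element space in `L²(D)`. -/
def toL2 (v : 𝒯.Vh) : L2 d L := (𝒯.Vh_memLp v).toLp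

end Triangulation

/-! ### The stochastic setting and the fully discrete scheme -/

/-- `W` is a real-valued Wiener process with respect to the filtration `ℱ`. -/
structure IsWienerProcess {Ω : Type*} {mΩ : MeasurableSpace Ω} (P : Measure Ω)
    (ℱ : Filtration ℝ≥0 mΩ) (W : ℝ≥0 → Ω → ℝ) : Prop where
  brownian : IsBrownianReal W P
  adapted : ∀ t, Measurable[ℱ t] (W t)
  indep : ∀ s t, s ≤ t → Indep (MeasurableSpace.comap (W t - W s) inferInstance) (ℱ s) P

/-- The fully discrete Milstein finite element scheme with drift `F(u) = u - u^q` on the uniform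
time grid `t_n = n τ`, `τ = T / N`, `n = 0, …, N`. -/
structure IsDiscreteSolution {d : ℕ} {L : ℝ} (𝒯 : Triangulation d L) (q : ℕ) (T : ℝ≥0) (N : ℕ)
    {Ω : Type*} {mΩ : MeasurableSpace Ω} (P : Measure Ω) (ℱ : Filtration ℝ≥0 mΩ)
    (W : ℝ≥0 → Ω → ℝ) (G : L2 d L → L2 d L) (DG : L2 d L → L2 d L →L[ℝ] L2 d L)
    (u₀ : Ω → L2 d L) (u : ℕ → Ω → 𝒯.Vh) : Prop where
  /-- `u^n` is measurable with respect to `ℱ_{t_n}`. -/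
  adapted : ∀ n ≤ N, ∀ x : E d, Measurable[ℱ (n * (T / N))] fun ω => (u n ω : E d → ℝ) x
  /-- `u^0` is the `L²`-projection of `u₀` to the finite element space. -/
  initial : ∀ᵐ ω ∂P, ∀ v : 𝒯.Vh, ip L (u 0 ω : E d → ℝ) (v : E d → ℝ) = ip L (u₀ ω : E d → ℝ) (v : E d → ℝ)
  /-- The equation that determines `u^{n+1}`. -/
  step : ∀ n < N, ∀ᵐ ω ∂P, ∀ v : 𝒯.Vh,
    let τ : ℝ := T / N
    let ΔW : ℝ := W ((n + 1) * (T / N)) ω - W (n * (T / N)) ω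
    let U : L2 d L := 𝒯.toL2 (u n ω)
    let φ : E d → ℝ := v
    let y : E d → ℝ := u n ω
    let z : E d → ℝ := u (n + 1) ω
    ip L (z - y) φ + τ * gip L z φ =
      τ * ip L (𝒯.interp fun x => z x - z x ^ q) φ
        + ip L (G U : E d → ℝ) φ * ΔW + 1 / 2 * ip L (DG U (G U) : E d → ℝ) φ * (ΔW ^ 2 - τ)

/-- The norm `‖f‖_{L^p(D)}` as an extended nonnegative real number. -/
def lpNorm {d : ℕ} {F : Type*} [NormedAddCommGroup F] (L : ℝ) (p : ℝ≥0∞) (f : E d → F) : ℝ≥0∞ :=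
  eLpNorm f p (volume.restrict (cube d L))

end StochFEM

end

set_option linter.unusedSectionVars false

namespace StochFEM

/-! ### Coercivity of the lumped nonlinearity in the nodal values of one simplex. -/

section Algebra

/-! The scheme is tested with its own solution `u^{n+1}`, and the resulting energy inequality is
summed by a discrete Gronwall argument. The delicate term is the drift: the product of the
interpolant of `z ^ q` with `z` has no sign pointwise, so its integral must be bounded below by
other means.

On a `d`-simplex the mass matrix of the barycentric coordinates is `r (I + J)`, where `J` is the
all-ones matrix. With nodal values `u_i`, the critical integral is therefore `r (∑ u_i^(q+1) + (∑
u_i^q)(∑ u_i))`. `exists_coercive` bounds this bracket below by `γ ∑ u_i^(q+1)`, with `γ > 0`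
depending only on `d` and `q`. For three nodes this works for every odd `q`, since two of three
reals share a weak sign; for four nodes a weighted Cauchy-Schwarz inequality settles `q = 3, 5`.
Jensen's inequality turns the nodal sum into the integral of `z ^ (q + 1)` (`setIntegral_pow_le`).
Summing over cells and absorbing `z ^ 2` by Young's inequality gives `ip_interp_le_const`: the drift
contributes at most a constant minus `δ ∫ z ^ (q + 1)`.

In the noise terms `z` is split as `y + (z - y)`, where `y = u^n`. The parts paired with `y` have
mean zero, because the Wiener increment is independent of the past; the parts paired with `z - y`
are absorbed into `‖z - y‖ ^ 2` (`energy_le`). What remains has expectation at most `τ` times a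
constant times `E‖y‖ ^ 2 + 1` (`lintegral_energy_le`). The factors `1 + O(τ)` of `N = T / τ` steps
multiply to a bound independent of `N` (`discrete_gronwall`). All expectations are lower integrals
in `ℝ≥0∞`, so no moment of `u^n` has to be known finite beforehand. -/

theorem odd_pow_add_mul_add_nonneg {q : ℕ} (hq : Odd q) (x y : ℝ) :
    0 ≤ (x ^ q + y ^ q) * (x + y) := by
  have hm := hq.strictMono_pow (R := ℝ)
  rcases le_total 0 (x + y) with h | h
  · have : (-x) ^ q ≤ y ^ q := hm.monotone (by linarith)
    rw [hq.neg_pow] at this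
    exact mul_nonneg (by linarith) h
  · have : y ^ q ≤ (-x) ^ q := hm.monotone (by linarith)
    rw [hq.neg_pow] at this
    exact mul_nonneg_of_nonpos_of_nonpos (by linarith) h

/-- If `y ≤ 2|x|`, the first term suffices. Otherwise `x > -y/2`, so both `x + y ≥ y/2` and `x^q +
y^q ≥ y^q/2`, and their product is at least a quarter of `y^(q+1)`. -/
theorem odd_pow_succ_le_of_nonneg {q : ℕ} (hq : Odd q) {x y : ℝ} (hy : 0 ≤ y) :
    y ^ (q + 1) ≤ 2 ^ (q + 1) * x ^ (q + 1) + 4 * ((x ^ q + y ^ q) * (x + y)) := by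
  have he : Even (q + 1) := hq.add_one
  have h0 := odd_pow_add_mul_add_nonneg hq x y
  rcases le_or_gt y (2 * |x|) with h | h
  · have := pow_le_pow_left₀ hy h (q + 1)
    rw [mul_pow, he.pow_abs] at this
    linarith
  · have hx : -(y / 2) ≤ x := by linarith [neg_abs_le x]
    have h1 : (-(y / 2)) ^ q ≤ x ^ q := (hq.strictMono_pow (R := ℝ)).monotone hx
    rw [hq.neg_pow] at h1
    have h2 : (y / 2) ^ q ≤ y ^ q / 2 := by
      rw [div_pow]
      refine div_le_div_of_nonneg_left (by positivity) (by norm_num) ?_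
      exact le_self_pow₀ (by norm_num) hq.pos.ne'
    have h3 : y ^ q / 2 * (y / 2) ≤ (x ^ q + y ^ q) * (x + y) := by
      apply mul_le_mul <;> first | linarith | positivity | skip
      have : 0 ≤ y ^ q := by positivity
      linarith
    have h4 : 0 ≤ (2 : ℝ) ^ (q + 1) * x ^ (q + 1) := mul_nonneg (by positivity) (he.pow_nonneg x)
    have h5 : y ^ (q + 1) = 4 * (y ^ q / 2 * (y / 2)) := by ring
    linarith

theorem odd_pow_succ_le {q : ℕ} (hq : Odd q) (x y : ℝ) :
    y ^ (q + 1) ≤ 2 ^ (q + 1) * x ^ (q + 1) + 4 * ((x ^ q + y ^ q) * (x + y)) := by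
  rcases le_total 0 y with h | h
  · exact odd_pow_succ_le_of_nonneg hq h
  · have := odd_pow_succ_le_of_nonneg hq (x := -x) (y := -y) (by linarith)
    rw [hq.neg_pow, hq.neg_pow, hq.add_one.neg_pow, hq.add_one.neg_pow] at this
    linarith

theorem pow_succ_add_le_of_mul_nonneg {q : ℕ} (hq : Odd q) {x y : ℝ} (h : 0 ≤ x * y) :
    x ^ (q + 1) + y ^ (q + 1) ≤ (x ^ q + y ^ q) * (x + y) := by
  obtain ⟨k, rfl⟩ := hq
  have h1 : 0 ≤ x ^ (2 * k) * (x * y) := mul_nonneg (by rw [pow_mul]; positivity) h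
  have h2 : 0 ≤ y ^ (2 * k) * (x * y) := mul_nonneg (by rw [pow_mul]; positivity) h
  linear_combination h1 + h2

/-- For three variables the bracket is exactly the sum over pairs of `(x^q + y^q)(x + y)`, each term
being nonnegative. The pair of equal sign controls its own two powers; the third power is then
controlled through `odd_pow_succ_le` by `x` and the pair `(x, z)`. -/
theorem coercive_three_of_mul_nonneg {q : ℕ} (hq : Odd q) {x y : ℝ} (z : ℝ) (h : 0 ≤ x * y) :
    x ^ (q + 1) + y ^ (q + 1) + z ^ (q + 1) ≤ (5 + 2 ^ (q + 1)) *
      ((x ^ (q + 1) + y ^ (q + 1) + z ^ (q + 1)) + (x ^ q + y ^ q + z ^ q) * (x + y + z)) := by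
  have h1 := pow_succ_add_le_of_mul_nonneg hq h
  have h2 := odd_pow_succ_le hq x z
  have h3 := odd_pow_add_mul_add_nonneg hq x z
  have h4 := odd_pow_add_mul_add_nonneg hq y z
  have h5 : 0 ≤ y ^ (q + 1) := hq.add_one.pow_nonneg y
  have h6 : 0 ≤ x ^ (q + 1) := hq.add_one.pow_nonneg x
  have hP : (0 : ℝ) ≤ 2 ^ (q + 1) := by positivity
  have e : (x ^ (q + 1) + y ^ (q + 1) + z ^ (q + 1)) + (x ^ q + y ^ q + z ^ q) * (x + y + z)
      = (x ^ q + y ^ q) * (x + y) + (x ^ q + z ^ q) * (x + z) + (y ^ q + z ^ q) * (y + z) := by ring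
  rw [e]
  generalize (2 : ℝ) ^ (q + 1) = p at *
  generalize (x ^ q + y ^ q) * (x + y) = A at *
  generalize (x ^ q + z ^ q) * (x + z) = B at *
  generalize (y ^ q + z ^ q) * (y + z) = D at *
  nlinarith [mul_nonneg hP h3, mul_nonneg hP h4, mul_nonneg hP h5,
    mul_le_mul_of_nonneg_left h1 hP]

/-- Coercivity of the lumped nonlinearity on a triangle. -/
theorem coercive_fin_three {q : ℕ} (hq : Odd q) (u : Fin 3 → ℝ) :
    ∑ i, u i ^ (q + 1) ≤ (5 + 2 ^ (q + 1)) * (∑ i, u i ^ (q + 1) + (∑ i, u i ^ q) * ∑ i, u i) := by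
  simp only [Fin.sum_univ_three]
  have : 0 ≤ u 0 * u 1 ∨ 0 ≤ u 0 * u 2 ∨ 0 ≤ u 1 * u 2 := by
    by_contra! h
    obtain ⟨h1, h2, h3⟩ := h
    have h4 := mul_pos_of_neg_of_neg h1 h2
    nlinarith [mul_pos_of_neg_of_neg h1 h2, sq_nonneg (u 0)]
  rcases this with h | h | h
  · exact coercive_three_of_mul_nonneg hq _ h
  · convert coercive_three_of_mul_nonneg hq (u 1) h using 1 <;> ring
  · convert coercive_three_of_mul_nonneg hq (u 0) h using 1 <;> ring

/-- If the weighted second moment and the `2q`-th moment are dominated by the `q+1`-st one, the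
lumped nonlinearity is coercive in four variables. -/
theorem coercive_fin_four_aux {q : ℕ} (u : Fin 4 → ℝ) (m : ℝ) (hm : 0 < m)
    (h1 : m * ∑ i, u i ^ 2 ≤ 2 * ∑ i, u i ^ (q + 1))
    (h2 : ∑ i, u i ^ (2 * q) ≤ m * ∑ i, u i ^ (q + 1)) :
    ∑ i, u i ^ (q + 1) ≤ 6 * (∑ i, u i ^ (q + 1) + (∑ i, u i ^ q) * ∑ i, u i) := by
  -- The weights 3 and 4 come from `(3mB - 4A)^2 = (3mB + 4A)^2 - 48mAB`, with `A = ∑ u_i^q` and `B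
  -- = ∑ u_i`. Cauchy-Schwarz then bounds `48mAB` below by `-4(18 - 24 + 16)mP = -40mP`, where `P =
  -- ∑ u_i^(q+1)`; so `P + AB ≥ P/6`.
  have hcs := sq_sum_le_card_mul_sum_sq (s := Finset.univ)
    (f := fun i => 3 * m * u i - 4 * u i ^ q)
  have e1 : ∑ i, (3 * m * u i - 4 * u i ^ q) = 3 * m * ∑ i, u i - 4 * ∑ i, u i ^ q := by
    rw [Finset.sum_sub_distrib, Finset.mul_sum, Finset.mul_sum]
  have e2 : ∑ i, (3 * m * u i - 4 * u i ^ q) ^ 2 = 9 * m ^ 2 * ∑ i, u i ^ 2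
      - 24 * m * ∑ i, u i ^ (q + 1) + 16 * ∑ i, u i ^ (2 * q) := by
    rw [Finset.mul_sum, Finset.mul_sum, Finset.mul_sum, ← Finset.sum_sub_distrib,
      ← Finset.sum_add_distrib]
    exact Finset.sum_congr rfl fun i _ => by ring
  rw [e1, e2] at hcs
  simp only [Finset.card_univ, Fintype.card_fin, Nat.cast_ofNat] at hcs
  generalize ∑ i, u i ^ (q + 1) = P at *
  generalize ∑ i, u i ^ (2 * q) = R at *
  generalize ∑ i, u i ^ 2 = S at *
  generalize ∑ i, u i ^ q = A at *
  generalize ∑ i, u i = B at *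
  have h3 : 48 * m * (A * B) ≥ -(4 * (9 * m ^ 2 * S - 24 * m * P + 16 * R)) := by
    nlinarith [sq_nonneg (3 * m * B + 4 * A)]
  have h4 : m * (m * S) ≤ m * (2 * P) := mul_le_mul_of_nonneg_left h1 hm.le
  have h5 : m * P ≤ m * (6 * (P + A * B)) := by nlinarith
  exact le_of_mul_le_mul_left h5 hm

/-- The auxiliary lemma applies with `m` the largest `u_i^(q-1)`, which makes the bound on the
`2q`-th powers termwise. In the second-moment bound the maximal index `j` leaves a surplus
`u_j^(q+1)`, shared equally among the three other indices. This sharing fails for `q = 7`, for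
instance at `u_i^2 = u_j^2 / 2`. -/
theorem coercive_fin_four {q : ℕ} (hq : q = 3 ∨ q = 5) (u : Fin 4 → ℝ) :
    ∑ i, u i ^ (q + 1) ≤ 6 * (∑ i, u i ^ (q + 1) + (∑ i, u i ^ q) * ∑ i, u i) := by
  obtain ⟨j, -, hj⟩ := Finset.exists_max_image Finset.univ (fun i => u i ^ 2)
    (Finset.univ_nonempty (α := Fin 4))
  have hj' : ∀ i, u i ^ 2 ≤ u j ^ 2 := fun i => hj i (Finset.mem_univ i)
  rcases (sq_nonneg (u j)).eq_or_lt with h0 | h0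
  · have : ∀ i, u i = 0 := fun i => by
      have := hj' i
      rw [← h0] at this
      exact pow_eq_zero_iff (two_ne_zero) |>.1 (le_antisymm this (sq_nonneg _))
    rcases hq with rfl | rfl <;> simp [this]
  have hsum : ∀ f : Fin 4 → ℝ, ∑ i, f i = f j + ∑ i ∈ Finset.univ.erase j, f i := fun f =>
    (Finset.add_sum_erase _ _ (Finset.mem_univ j)).symm
  have hcard : (Finset.univ.erase j).card = 3 := by simp
  rcases hq with rfl | rfl
  · refine coercive_fin_four_aux u (u j ^ 2) h0 ?_ ?_
    · rw [hsum, hsum (fun i => u i ^ (3 + 1)), mul_add, mul_add, Finset.mul_sum, Finset.mul_sum]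
      have : ∑ i ∈ Finset.univ.erase j, u j ^ 2 * u i ^ 2 ≤
          ∑ i ∈ Finset.univ.erase j, (2 * u i ^ (3 + 1) + (u j ^ 2) ^ 2 / 3) :=
        Finset.sum_le_sum fun i _ => by
          nlinarith [sq_nonneg (4 * u i ^ 2 - u j ^ 2), sq_nonneg (u j ^ 2)]
      rw [Finset.sum_add_distrib, Finset.sum_const, hcard] at this
      simp only [nsmul_eq_mul, Nat.cast_ofNat] at this
      linear_combination this
    · rw [Finset.mul_sum]
      refine Finset.sum_le_sum fun i _ => ?_
      have := mul_le_mul_of_nonneg_right (hj' i) (by positivity : 0 ≤ u i ^ 4)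
      linear_combination this
  · refine coercive_fin_four_aux u ((u j ^ 2) ^ 2) (by positivity) ?_ ?_
    · rw [hsum, hsum (fun i => u i ^ (5 + 1)), mul_add, mul_add, Finset.mul_sum, Finset.mul_sum]
      have : ∑ i ∈ Finset.univ.erase j, (u j ^ 2) ^ 2 * u i ^ 2 ≤
          ∑ i ∈ Finset.univ.erase j, (2 * u i ^ (5 + 1) + (u j ^ 2) ^ 3 / 3) :=
        Finset.sum_le_sum fun i _ => by
          have hb : 0 ≤ u i ^ 2 := sq_nonneg _
          have e : u i ^ (5 + 1) = (u i ^ 2) ^ 3 := by ring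
          rw [e]
          generalize u i ^ 2 = b at *
          generalize u j ^ 2 = a at *
          -- With `t = 41/100`, close to the minimizer `1/√6` of `2b^3 - b`, the product is `2b^3 -
          -- 6t^2 a^2 b + 4t^3 a^3`. The two corrections use `6t^2 ≥ 1` and `4t^3 ≤ 1/3`.
          have h1 := mul_nonneg (by linarith : 0 ≤ 2 * b + (41 / 25) * a)
            (sq_nonneg (b - 41 / 100 * a))
          linear_combination h1 + (6 * (41 / 100) ^ 2 - 1) * mul_nonneg hb (sq_nonneg a) +
            (1 / 3 - 4 * (41 / 100) ^ 3) * (pow_pos h0 3).le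
      rw [Finset.sum_add_distrib, Finset.sum_const, hcard] at this
      simp only [nsmul_eq_mul, Nat.cast_ofNat] at this
      linear_combination this
    · rw [Finset.mul_sum]
      refine Finset.sum_le_sum fun i _ => ?_
      have h3 : (u i ^ 2) ^ 2 ≤ (u j ^ 2) ^ 2 := pow_le_pow_left₀ (sq_nonneg _) (hj' i) 2
      have := mul_le_mul_of_nonneg_right h3 (by positivity : 0 ≤ u i ^ 6)
      linear_combination this

/-- Coercivity of the lumped nonlinearity on a simplex, in the dimensions and for the exponents
under consideration. -/
theorem exists_coercive {d q : ℕ} (hdq : (d = 2 ∧ Odd q ∧ 3 ≤ q) ∨ (d = 3 ∧ (q = 3 ∨ q = 5))) :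
    ∃ γ : ℝ, 0 < γ ∧ ∀ u : Fin (d + 1) → ℝ,
      γ * ∑ i, u i ^ (q + 1) ≤ ∑ i, u i ^ (q + 1) + (∑ i, u i ^ q) * ∑ i, u i := by
  rcases hdq with ⟨rfl, hq, -⟩ | ⟨rfl, hq⟩
  · refine ⟨(5 + 2 ^ (q + 1))⁻¹, by positivity, fun u => ?_⟩
    rw [inv_mul_le_iff₀ (by positivity)]
    exact coercive_fin_three hq u
  · refine ⟨6⁻¹, by positivity, fun u => ?_⟩
    rw [inv_mul_le_iff₀ (by positivity)]
    exact coercive_fin_four hq u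

theorem sq_le_add_mul_pow {q : ℕ} (hq : Odd q) (hq3 : 3 ≤ q) {ε : ℝ} (hε : 0 < ε) (x : ℝ) :
    x ^ 2 ≤ (1 + ε⁻¹) + ε * x ^ (q + 1) := by
  have he := hq.add_one
  obtain ⟨k, hk⟩ := he
  have hk2 : 2 ≤ k := by omega
  have e : x ^ (q + 1) = (x ^ 2) ^ k := by rw [hk, ← pow_mul]; congr 1; omega
  rw [e]
  have hx := sq_nonneg x
  generalize x ^ 2 = a at *
  have hεi : 0 < ε⁻¹ := inv_pos.2 hε
  rcases le_total a 1 with h | h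
  · have : 0 ≤ ε * a ^ k := by positivity
    linarith
  · have h2 : a ^ 2 ≤ a ^ k := pow_le_pow_right₀ h hk2
    have h3 : ε * a ^ 2 ≤ ε * a ^ k := mul_le_mul_of_nonneg_left h2 hε.le
    have h4 : ε * ε⁻¹ = 1 := mul_inv_cancel₀ hε.ne'
    have h5 : 0 ≤ ε * (a - ε⁻¹) ^ 2 := by positivity
    nlinarith

end Algebra

/-! ### The mass matrix of a simplex, from symmetry and bisection. -/

section Simplex

variable {V : Type*} [NormedAddCommGroup V] [NormedSpace ℝ V] [FiniteDimensional ℝ V]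
  [MeasurableSpace V] [BorelSpace V] (μ : Measure V) [μ.IsAddHaarMeasure]

/-- Change of variables for the affine transvection `x ↦ x + ℓ x • w`. -/
theorem integral_comp_affine_transvection (ℓ : V →ᵃ[ℝ] ℝ) (w : V) (h : 1 + ℓ.linear w ≠ 0)
    {F : V → ℝ} (hF : AEStronglyMeasurable F μ) :
    ∫ x, F x ∂μ = |1 + ℓ.linear w| * ∫ x, F (x + ℓ x • w) ∂μ := by
  set A : V →ₗ[ℝ] V := LinearMap.transvection ℓ.linear w with hA
  have hdet : LinearMap.det A = 1 + ℓ.linear w := LinearMap.transvection.det ..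
  have hAm : Measurable A := A.continuous_of_finiteDimensional.measurable
  have hmap : μ.map A = ENNReal.ofReal |(LinearMap.det A)⁻¹| • μ :=
    Measure.map_linearMap_addHaar_eq_smul_addHaar μ (by rwa [hdet])
  have hT : (fun x => F (x + ℓ x • w)) = fun x => F (A x + ℓ 0 • w) := by
    funext x
    have : ℓ x = ℓ.linear x + ℓ 0 := by
      simpa using (ℓ.map_vadd 0 x)
    rw [this, hA, LinearMap.transvection.apply, add_smul, add_assoc]
  have hF' : AEStronglyMeasurable (fun y => F (y + ℓ 0 • w)) (μ.map A) := by
    rw [hmap]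
    exact (hF.comp_quasiMeasurePreserving
      (measurePreserving_add_right μ (ℓ 0 • w)).quasiMeasurePreserving).smul_measure _
  rw [hT, ← integral_map hAm.aemeasurable hF', hmap, integral_smul_measure,
    integral_add_right_eq_self (μ := μ) F, hdet, ENNReal.toReal_ofReal (abs_nonneg _), abs_inv,
    smul_eq_mul, ← mul_assoc, mul_inv_cancel₀ (abs_ne_zero.2 h), one_mul]

variable {ι : Type*} [Fintype ι] [DecidableEq ι] (b : AffineBasis ι ℝ V)

/-- The simplex spanned by an affine basis. -/
def simplexOf : Set V := convexHull ℝ (range b)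

theorem mem_simplexOf {x : V} : x ∈ simplexOf b ↔ ∀ i, 0 ≤ b.coord i x := by
  rw [simplexOf, AffineBasis.convexHull_eq_nonneg_coord]; rfl

theorem isCompact_simplexOf : IsCompact (simplexOf b) :=
  (finite_range b).isCompact_convexHull (𝕜 := ℝ)

theorem continuous_coords : Continuous fun x i => b.coord i x :=
  continuous_pi fun i => (b.coord i).continuous_of_finiteDimensional

theorem coord_linear_sub (i j k : ι) :
    (b.coord k).linear (b i - b j) = (if k = i then 1 else 0) - if k = j then 1 else 0 := by
  have := (b.coord k).linearMap_vsub (b i) (b j)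
  rw [vsub_eq_sub, vsub_eq_sub] at this
  rw [this, b.coord_apply, b.coord_apply]

theorem coord_add_smul_sub (ℓ : V →ᵃ[ℝ] ℝ) (r : ℝ) (i j k : ι) (x : V) :
    b.coord k (x + ℓ x • r • (b i - b j)) =
      b.coord k x + ℓ x * r * ((if k = i then 1 else 0) - if k = j then 1 else 0) := by
  have := (b.coord k).map_vadd x (ℓ x • r • (b i - b j))
  rw [vadd_eq_add, vadd_eq_add, add_comm] at this
  rw [this, map_smul, map_smul, coord_linear_sub, smul_eq_mul, smul_eq_mul]
  ring

/-- The integral over a simplex is invariant under transposition of two vertices. -/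
theorem setIntegral_simplexOf_swap (i j : ι) (hij : i ≠ j) {f : (ι → ℝ) → ℝ} (hf : Continuous f) :
    ∫ x in simplexOf b, f (fun k => b.coord k x) ∂μ =
      ∫ x in simplexOf b, f (fun k => b.coord (Equiv.swap i j k) x) ∂μ := by
  have hK := (isCompact_simplexOf b).isClosed.measurableSet
  set F : V → ℝ := (simplexOf b).indicator fun x => f fun k => b.coord k x with hFd
  have hF : AEStronglyMeasurable F μ :=
    ((hf.comp (continuous_coords b)).aestronglyMeasurable).indicator hK
  have hc := fun x k => coord_add_smul_sub b (b.coord j - b.coord i) 1 i j k x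
  have hc' : ∀ x k, b.coord k (x + (b.coord j - b.coord i) x • (1 : ℝ) • (b i - b j)) =
      b.coord (Equiv.swap i j k) x := by
    intro x k
    rw [hc, AffineMap.coe_sub, Pi.sub_apply]
    rcases eq_or_ne k i with rfl | hki
    · simp [hij]
    · rcases eq_or_ne k j with rfl | hkj
      · simp [hki]
      · simp [hki, hkj, Equiv.swap_apply_of_ne_of_ne hki hkj]
  -- The swap of two vertices is a transvection of determinant `1 - 2 = -1`.
  have hlin : (b.coord j - b.coord i).linear ((1 : ℝ) • (b i - b j)) = -2 := by
    rw [one_smul, AffineMap.sub_linear, LinearMap.sub_apply, coord_linear_sub, coord_linear_sub]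
    simp [hij, hij.symm]; norm_num
  have key := integral_comp_affine_transvection μ (b.coord j - b.coord i)
    ((1 : ℝ) • (b i - b j)) (by rw [hlin]; norm_num) hF
  rw [hlin, hFd, integral_indicator hK] at key
  rw [key, ← integral_indicator hK]
  norm_num
  congr 1
  funext x
  have hiff : x + (b.coord j x - b.coord i x) • (b i - b j) ∈ simplexOf b ↔ x ∈ simplexOf b := by
    rw [mem_simplexOf, mem_simplexOf]
    have : ∀ k, b.coord k (x + (b.coord j x - b.coord i x) • (b i - b j)) =
      b.coord (Equiv.swap i j k) x := fun k => by simpa using hc' x k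
    simp only [this]
    exact (Equiv.swap i j).forall_congr_right (q := fun k => 0 ≤ b.coord k x)
  have hv : ∀ k, b.coord k (x + (b.coord j x - b.coord i x) • (b i - b j)) =
      b.coord (Equiv.swap i j k) x := fun k => by simpa using hc' x k
  by_cases hx : x ∈ simplexOf b
  · rw [indicator_of_mem hx, indicator_of_mem (hiff.2 hx)]
    simp only [hv]
  · rw [indicator_of_notMem hx, indicator_of_notMem (mt hiff.1 hx)]

/-- The integral over the half of a simplex next to the vertex `b i` that arises by bisecting the
edge from `b i` to `b j`. -/
theorem setIntegral_simplexOf_bisect (i j : ι) (hij : i ≠ j) {f : (ι → ℝ) → ℝ}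
    (hf : Continuous f) :
    ∫ x in simplexOf b ∩ {x | b.coord j x ≤ b.coord i x}, f (fun k => b.coord k x) ∂μ =
      1 / 2 * ∫ x in simplexOf b, f (fun k => b.coord k x + b.coord j x * (1 / 2) *
        ((if k = i then 1 else 0) - if k = j then 1 else 0)) ∂μ := by
  have hK := (isCompact_simplexOf b).isClosed.measurableSet
  have hK' : MeasurableSet (simplexOf b ∩ {x | b.coord j x ≤ b.coord i x}) :=
    hK.inter (isClosed_le (b.coord j).continuous_of_finiteDimensional
      (b.coord i).continuous_of_finiteDimensional).measurableSet
  set F : V → ℝ := (simplexOf b ∩ {x | b.coord j x ≤ b.coord i x}).indicator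
    fun x => f fun k => b.coord k x with hFd
  have hF : AEStronglyMeasurable F μ :=
    ((hf.comp (continuous_coords b)).aestronglyMeasurable).indicator hK'
  have hc := fun x k => coord_add_smul_sub b (b.coord j) (1 / 2) i j k x
  -- The map fixes every vertex except `b j`, which goes to the midpoint of the edge; its
  -- determinant is `1 - 1/2`.
  have hlin : (b.coord j).linear ((1 / 2 : ℝ) • (b i - b j)) = -(1 / 2) := by
    rw [map_smul, coord_linear_sub]
    simp [hij.symm]
  have key := integral_comp_affine_transvection μ (b.coord j)
    ((1 / 2 : ℝ) • (b i - b j)) (by rw [hlin]; norm_num) hF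
  rw [hlin, hFd, integral_indicator hK'] at key
  rw [key, ← integral_indicator hK, show |1 + -(1 / 2 : ℝ)| = 1 / 2 by norm_num [abs_of_pos]]
  congr 2
  funext x
  have hiff : x + b.coord j x • (1 / 2 : ℝ) • (b i - b j) ∈
      simplexOf b ∩ {x | b.coord j x ≤ b.coord i x} ↔ x ∈ simplexOf b := by
    rw [mem_inter_iff, mem_ofPred_eq, mem_simplexOf, mem_simplexOf]
    simp only [hc]
    constructor
    · rintro ⟨h1, h2⟩ k
      have hj : 0 ≤ b.coord j x := by
        have := h1 j
        simp only [hij.symm, if_true, if_false] at this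
        linarith
      rcases eq_or_ne k i with rfl | hki
      · simp only [hij, hij.symm, if_true, if_false] at h2
        linarith
      · have := h1 k
        rcases eq_or_ne k j with rfl | hkj
        · exact hj
        · simpa [hki, hkj] using this
    · intro h
      refine ⟨fun k => ?_, ?_⟩
      · have h1 := h k
        have h2 := h j
        split_ifs <;> first | linarith | (subst_vars; linarith)
      · simp only [hij, hij.symm, if_true, if_false]
        linarith [h i]
  by_cases hx : x ∈ simplexOf b
  · rw [indicator_of_mem hx, indicator_of_mem (hiff.2 hx)]
    simp only [hc]
  · rw [indicator_of_notMem hx, indicator_of_notMem (mt hiff.1 hx)]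

/-- The two halves of a bisected simplex overlap only in this set, a proper affine subspace since it
misses `b i`. -/
theorem measure_coord_eq_zero (i j : ι) (hij : i ≠ j) : μ {x | b.coord i x = b.coord j x} = 0 := by
  have e : {x | b.coord i x = b.coord j x} =
      (((AffineSubspace.mk' (0 : ℝ) ⊥).comap (b.coord i - b.coord j) : AffineSubspace ℝ V) :
        Set V) := by
    ext x
    simp [AffineSubspace.mem_mk', sub_eq_zero]
  rw [e]
  refine Measure.addHaar_affineSubspace _ _ fun h => ?_
  have : b i ∈ ((AffineSubspace.mk' (0 : ℝ) ⊥).comap (b.coord i - b.coord j)) := by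
    rw [h]; trivial
  simp [AffineSubspace.mem_mk', b.coord_apply, hij.symm] at this

theorem integrableOn_simplexOf {f : (ι → ℝ) → ℝ} (hf : Continuous f) :
    IntegrableOn (fun x => f fun k => b.coord k x) (simplexOf b) μ :=
  (hf.comp (continuous_coords b)).continuousOn.integrableOn_compact (isCompact_simplexOf b)

/-- Bisecting the edge `ij` and pulling each half back to the whole simplex expresses `∫ c_i c_j` as
`1/2 ∫ c_i c_j + 1/8 (∫ c_i^2 + ∫ c_j^2)`. The two squares have equal integrals by symmetry, so this
self-similarity fixes the ratio without computing either integral. -/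
theorem setIntegral_coord_sq (i j : ι) (hij : i ≠ j) :
    ∫ x in simplexOf b, b.coord i x ^ 2 ∂μ = 2 * ∫ x in simplexOf b, b.coord i x * b.coord j x ∂μ := by
  have hsw := setIntegral_simplexOf_swap μ b i j hij (f := fun c => c i ^ 2) (by fun_prop)
  have h1 := setIntegral_simplexOf_bisect μ b i j hij (f := fun c => c i * c j) (by fun_prop)
  have h2 := setIntegral_simplexOf_bisect μ b j i hij.symm (f := fun c => c i * c j) (by fun_prop)
  have hI := integrableOn_simplexOf μ b (f := fun c => c i * c j) (by fun_prop)
  have hmi : Measurable (b.coord i) := (b.coord i).continuous_of_finiteDimensional.measurable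
  have hmj : Measurable (b.coord j) := (b.coord j).continuous_of_finiteDimensional.measurable
  have hsplit : ∫ x in simplexOf b, b.coord i x * b.coord j x ∂μ =
      ∫ x in simplexOf b ∩ {x | b.coord j x ≤ b.coord i x}, b.coord i x * b.coord j x ∂μ +
      ∫ x in simplexOf b ∩ {x | b.coord i x ≤ b.coord j x}, b.coord i x * b.coord j x ∂μ := by
    rw [← setIntegral_union₀ _ (((isCompact_simplexOf b).isClosed.measurableSet.inter
      (measurableSet_le hmi hmj))).nullMeasurableSet (hI.mono_set inter_subset_left)
      (hI.mono_set inter_subset_left), ← inter_union_distrib_left]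
    · congr 2
      refine (inter_eq_left.2 fun x _ => ?_).symm
      exact (le_total (b.coord j x) (b.coord i x))
    · refine measure_mono_null (fun x hx => ?_) (measure_coord_eq_zero μ b i j hij)
      exact le_antisymm hx.2.2 hx.1.2
  simp only [hij, hij.symm, if_true, if_false, Equiv.swap_apply_left] at h1 h2 hsw
  have hA := integrableOn_simplexOf μ b (f := fun c => 1 / 2 * (c i * c j)) (by fun_prop)
  have hB := integrableOn_simplexOf μ b (f := fun c => 1 / 4 * (c j ^ 2)) (by fun_prop)
  have hB' := integrableOn_simplexOf μ b (f := fun c => 1 / 4 * (c i ^ 2)) (by fun_prop)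
  have e1 : ∫ x in simplexOf b, (b.coord i x + b.coord j x * (1 / 2) * (1 - 0)) *
      (b.coord j x + b.coord j x * (1 / 2) * (0 - 1)) ∂μ =
      1 / 2 * ∫ x in simplexOf b, b.coord i x * b.coord j x ∂μ +
        1 / 4 * ∫ x in simplexOf b, b.coord j x ^ 2 ∂μ := by
    rw [← integral_const_mul, ← integral_const_mul, ← integral_add hA hB]
    congr 1; funext x; ring
  have e2 : ∫ x in simplexOf b, (b.coord i x + b.coord i x * (1 / 2) * (0 - 1)) *
      (b.coord j x + b.coord i x * (1 / 2) * (1 - 0)) ∂μ =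
      1 / 2 * ∫ x in simplexOf b, b.coord i x * b.coord j x ∂μ +
        1 / 4 * ∫ x in simplexOf b, b.coord i x ^ 2 ∂μ := by
    rw [← integral_const_mul, ← integral_const_mul, ← integral_add hA hB']
    congr 1; funext x; ring
  rw [e1] at h1
  rw [e2] at h2
  rw [h1, h2, ← hsw] at hsplit
  linarith

theorem sum_coord_mul_of_forall_ne {r : ℝ} (p : ι → ℝ) (i : ι) (B : ι → ℝ)
    (h1 : B i = 2 * r) (h2 : ∀ j, j ≠ i → B j = r) :
    ∑ j, p j * B j = r * (p i + ∑ j, p j) := by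
  rw [← Finset.add_sum_erase _ _ (Finset.mem_univ i),
    ← Finset.add_sum_erase Finset.univ p (Finset.mem_univ i), h1,
    Finset.sum_congr rfl fun j hj => by rw [h2 j (Finset.ne_of_mem_erase hj)], ← Finset.sum_mul]
  ring

theorem exists_setIntegral_coord_mul : ∃ r : ℝ, 0 ≤ r ∧
    (∀ i, ∫ x in simplexOf b, b.coord i x ^ 2 ∂μ = 2 * r) ∧
    ∀ i j, i ≠ j → ∫ x in simplexOf b, b.coord i x * b.coord j x ∂μ = r := by
  rcases isEmpty_or_nonempty ι with hι | ⟨⟨i₀⟩⟩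
  · exact ⟨0, le_rfl, fun i => (hι.false i).elim, fun i => (hι.false i).elim⟩
  have hsq : ∀ i, ∫ x in simplexOf b, b.coord i x ^ 2 ∂μ =
      ∫ x in simplexOf b, b.coord i₀ x ^ 2 ∂μ := fun i => by
    rcases eq_or_ne i i₀ with rfl | h
    · rfl
    · simpa using setIntegral_simplexOf_swap μ b i i₀ h (f := fun c => c i ^ 2) (by fun_prop)
  refine ⟨(∫ x in simplexOf b, b.coord i₀ x ^ 2 ∂μ) / 2, ?_, fun i => ?_, fun i j hij => ?_⟩
  · exact div_nonneg (integral_nonneg fun x => sq_nonneg _) zero_le_two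
  · rw [hsq]; ring
  · have := setIntegral_coord_sq μ b i j hij
    rw [hsq] at this
    linarith

/-- The mass matrix of a simplex, as a bilinear form of nodal values, together with the integrals
of the barycentric coordinates. -/
theorem exists_mass_matrix : ∃ r : ℝ, 0 ≤ r ∧
    (∀ p s : ι → ℝ, ∫ x in simplexOf b, (∑ i, p i * b.coord i x) * (∑ i, s i * b.coord i x) ∂μ =
      r * (∑ i, p i * s i + (∑ i, p i) * ∑ i, s i)) ∧
    ∀ p : ι → ℝ, ∫ x in simplexOf b, ∑ i, p i * b.coord i x ∂μ =
      r * (Fintype.card ι + 1) * ∑ i, p i := by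
  obtain ⟨r, hr0, hsq, hne⟩ := exists_setIntegral_coord_mul μ b
  have hbil : ∀ p s : ι → ℝ,
      ∫ x in simplexOf b, (∑ i, p i * b.coord i x) * (∑ i, s i * b.coord i x) ∂μ =
      r * (∑ i, p i * s i + (∑ i, p i) * ∑ i, s i) := by
    intro p s
    have hint : ∀ i j, IntegrableOn (fun x => p i * (s j * (b.coord i x * b.coord j x)))
        (simplexOf b) μ := fun i j =>
      integrableOn_simplexOf μ b (f := fun c => p i * (s j * (c i * c j))) (by fun_prop)
    have e : ∀ x, (∑ i, p i * b.coord i x) * (∑ i, s i * b.coord i x) =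
        ∑ i, ∑ j, p i * (s j * (b.coord i x * b.coord j x)) := fun x => by
      rw [Finset.sum_mul_sum]
      exact Finset.sum_congr rfl fun i _ => Finset.sum_congr rfl fun j _ => by ring
    simp only [e]
    rw [integral_finsetSum _ fun i _ => integrable_finsetSum _ fun j _ => hint i j]
    have : ∀ i, ∫ x in simplexOf b, ∑ j, p i * (s j * (b.coord i x * b.coord j x)) ∂μ =
        p i * (r * (s i + ∑ j, s j)) := fun i => by
      rw [integral_finsetSum _ fun j _ => hint i j]
      simp only [integral_const_mul]
      rw [← Finset.mul_sum, sum_coord_mul_of_forall_ne s i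
        (fun j => ∫ x in simplexOf b, b.coord i x * b.coord j x ∂μ) _ fun j hj => hne i j hj.symm]
      simpa only [pow_two] using hsq i
    simp only [this]
    rw [mul_add, Finset.mul_sum, Finset.sum_mul, Finset.mul_sum, ← Finset.sum_add_distrib]
    exact Finset.sum_congr rfl fun i _ => by ring
  refine ⟨r, hr0, hbil, fun p => ?_⟩
  -- The barycentric coordinates sum to one, so the linear integrals are the bilinear ones against
  -- the constant nodal vector 1.
  have h1 := hbil p fun _ => 1
  have e : ∀ x, (∑ i, p i * b.coord i x) * (∑ i, 1 * b.coord i x) = ∑ i, p i * b.coord i x :=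
    fun x => by simp only [one_mul]; rw [b.sum_coord_apply_eq_one, mul_one]
  simp only [e] at h1
  rw [h1]
  simp
  ring

/-- On a simplex, the integral of the interpolant of `z ^ q` times `z` dominates the integral of
`z ^ (q + 1)`. -/
theorem setIntegral_pow_le {q : ℕ} (hq : Odd q) {γ : ℝ} (u : ι → ℝ)
    (hγ : γ * ∑ i, u i ^ (q + 1) ≤ ∑ i, u i ^ (q + 1) + (∑ i, u i ^ q) * ∑ i, u i) (hγ0 : 0 ≤ γ) :
    γ / (Fintype.card ι + 1) * ∫ x in simplexOf b, (∑ i, u i * b.coord i x) ^ (q + 1) ∂μ ≤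
      ∫ x in simplexOf b, (∑ i, u i ^ q * b.coord i x) * (∑ i, u i * b.coord i x) ∂μ := by
  obtain ⟨r, hr0, hbil, hlin⟩ := exists_mass_matrix μ b
  -- Jensen's inequality for the even power, with the barycentric coordinates as weights.
  have hconv : ∫ x in simplexOf b, (∑ i, u i * b.coord i x) ^ (q + 1) ∂μ ≤
      ∫ x in simplexOf b, ∑ i, u i ^ (q + 1) * b.coord i x ∂μ := by
    refine setIntegral_mono_on
      (integrableOn_simplexOf μ b (f := fun c => (∑ i, u i * c i) ^ (q + 1)) (by fun_prop))
      (integrableOn_simplexOf μ b (f := fun c => ∑ i, u i ^ (q + 1) * c i) (by fun_prop))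
      (isCompact_simplexOf b).isClosed.measurableSet fun x hx => ?_
    have := hq.add_one.convexOn_pow.map_sum_le (t := Finset.univ) (w := fun i => b.coord i x)
      (p := u) (fun i _ => (mem_simplexOf b).1 hx i) (b.sum_coord_apply_eq_one x)
      (fun i _ => mem_univ _)
    simpa only [smul_eq_mul, mul_comm] using this
  rw [hlin] at hconv
  rw [hbil, div_mul_eq_mul_div, div_le_iff₀ (by positivity)]
  refine (mul_le_mul_of_nonneg_left hconv hγ0).trans ?_
  have := mul_le_mul_of_nonneg_left hγ
    (mul_nonneg hr0 (by positivity : (0 : ℝ) ≤ Fintype.card ι + 1))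
  simp only [← pow_succ]
  linarith

end Simplex

/-! ### Barycentric coordinates and cells of the triangulation. -/

section Mesh

variable {d : ℕ} {L : ℝ}

theorem mem_convexHull_iff_isBarycentric {s : Finset (E d)} {x : E d} :
    x ∈ convexHull ℝ (s : Set (E d)) ↔ ∃ w, IsBarycentric s x w := by
  classical
  rw [Finset.mem_convexHull']
  constructor
  · rintro ⟨w, h0, h1, h2⟩
    refine ⟨fun y => if y ∈ s then w y else 0, fun y hy => ?_, fun y hy => if_neg hy, ?_, ?_⟩
    · simpa [hy] using h0 y hy
    · rw [← h1]
      exact Finset.sum_congr rfl fun y hy => if_pos hy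
    · rw [← h2]
      exact Finset.sum_congr rfl fun y hy => by simp only [if_pos hy]
  · rintro ⟨w, h0, -, h1, h2⟩
    exact ⟨w, h0, h1, h2⟩

theorem IsBarycentric.mono {s t : Finset (E d)} {x : E d} {w : E d → ℝ} (h : IsBarycentric s x w)
    (hst : s ⊆ t) : IsBarycentric t x w := by
  obtain ⟨h0, h1, h2, h3⟩ := h
  refine ⟨fun y _ => ?_, fun y hy => h1 y (mt (@hst y) hy), ?_, ?_⟩
  · by_cases hy : y ∈ s
    · exact h0 y hy
    · exact (h1 y hy).ge
  · rw [← h2]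
    exact (Finset.sum_subset hst fun y _ hy => h1 y hy).symm
  · rw [← h3]
    exact (Finset.sum_subset hst fun y _ hy => by rw [h1 y hy, zero_smul]).symm

theorem IsBarycentric.eq {s : Finset (E d)} (hs : AffineIndependent ℝ ((↑) : s → E d)) {x : E d}
    {w w' : E d → ℝ} (h : IsBarycentric s x w) (h' : IsBarycentric s x w') : w = w' := by
  funext y
  by_cases hy : y ∈ s
  · refine sub_eq_zero.1 (hs.eq_zero_of_sum_eq_zero_subtype (w := fun y => w y - w' y) ?_ ?_ y hy)
    · rw [Finset.sum_sub_distrib, h.2.2.1, h'.2.2.1, sub_self]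
    · simp only [sub_smul]
      rw [Finset.sum_sub_distrib, h.2.2.2, h'.2.2.2, sub_self]
  · rw [h.2.1 y hy, h'.2.1 y hy]

theorem convex_cube : Convex ℝ (cube d L) := by
  have : cube d L = ⋂ i, (EuclideanSpace.proj i : E d →L[ℝ] ℝ) ⁻¹' Ioo 0 L := by
    ext x; simp [cube]
  rw [this]
  exact convex_iInter fun i => (convex_Ioo 0 L).linear_preimage
    (EuclideanSpace.proj i : E d →L[ℝ] ℝ).toLinearMap

theorem volume_cube_lt_top : volume (cube d L) < ∞ :=
  (Triangulation.cube_isBounded d L).measure_lt_top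

instance : IsFiniteMeasure (volume.restrict (cube d L)) :=
  ⟨by simpa using volume_cube_lt_top⟩

theorem volume_convexHull_eq_zero {s : Finset (E d)} (h : s.card ≤ d) :
    volume (convexHull ℝ (s : Set (E d))) = 0 := by
  refine measure_mono_null (convexHull_subset_affineSpan _)
    (Measure.addHaar_affineSubspace _ _ fun htop => ?_)
  rcases s.eq_empty_or_nonempty with rfl | hne
  · simp at htop
  have h1 := finrank_vectorSpan_range_le ℝ ((↑) : s → E d) (n := s.card - 1)
    (by have := hne.card_pos; rw [Fintype.card_coe]; omega)
  have h2 : vectorSpan ℝ (range ((↑) : s → E d)) = ⊤ := by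
    have hr : range ((↑) : s → E d) = (s : Set (E d)) := by simp
    rw [hr, ← direction_affineSpan, htop, AffineSubspace.direction_top]
  rw [h2, finrank_top, finrank_euclideanSpace, Fintype.card_fin] at h1
  have := hne.card_pos
  omega

namespace Triangulation

variable (𝒯 : Triangulation d L)

theorem mem_cells {K : Finset (E d)} : K ∈ 𝒯.cells ↔ K ∈ 𝒯.complex.faces ∧ K.card = d + 1 := by
  simp [cells]

theorem mem_vertices {a : E d} : a ∈ 𝒯.vertices ↔ ∃ s ∈ 𝒯.complex.faces, a ∈ s := by
  simp [vertices]

/-- Barycentric coordinates do not depend on the simplex. -/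
theorem isBarycentric_unique {s t : Finset (E d)} (hs : s ∈ 𝒯.complex.faces)
    (ht : t ∈ 𝒯.complex.faces) {x : E d} {w w' : E d → ℝ} (h : IsBarycentric s x w)
    (h' : IsBarycentric t x w') : w = w' := by
  classical
  -- The point lies in the common face; its coordinates there, extended by zero, are its coordinates
  -- in both simplices.
  have hx := 𝒯.complex.inter_subset_convexHull hs ht
    ⟨mem_convexHull_iff_isBarycentric.2 ⟨w, h⟩, mem_convexHull_iff_isBarycentric.2 ⟨w', h'⟩⟩
  rw [← Finset.coe_inter, mem_convexHull_iff_isBarycentric] at hx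
  obtain ⟨w'', h''⟩ := hx
  rw [h.eq (𝒯.complex.indep hs) (h''.mono Finset.inter_subset_left),
    h'.eq (𝒯.complex.indep ht) (h''.mono Finset.inter_subset_right)]

theorem hat_eq {s : Finset (E d)} (hs : s ∈ 𝒯.complex.faces) {x : E d} {w : E d → ℝ}
    (h : IsBarycentric s x w) (a : E d) : 𝒯.hat a x = w a := by
  have hex : ∃ w : E d → ℝ, ∃ s ∈ 𝒯.complex.faces, IsBarycentric s x w := ⟨w, s, hs, h⟩
  rw [hat, dif_pos hex]
  obtain ⟨t, ht, h'⟩ := hex.choose_spec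
  rw [𝒯.isBarycentric_unique ht hs h' h]

theorem interp_eq {s : Finset (E d)} (hs : s ∈ 𝒯.complex.faces) {x : E d} {w : E d → ℝ}
    (h : IsBarycentric s x w) (f : E d → ℝ) : 𝒯.interp f x = ∑ a ∈ s, f a * w a := by
  rw [interp]
  simp only [𝒯.hat_eq hs h]
  refine (Finset.sum_subset (fun a ha => 𝒯.mem_vertices.2 ⟨s, hs, ha⟩) fun a _ ha => ?_).symm
  rw [h.2.1 a ha, mul_zero]

/-- The vertices of a cell, as an affine basis. -/
def cellBasis (K : 𝒯.cells) : AffineBasis K.1 ℝ (E d) :=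
  ⟨(↑), 𝒯.complex.indep (𝒯.mem_cells.1 K.2).1, by
    rw [(𝒯.complex.indep (𝒯.mem_cells.1 K.2).1).affineSpan_eq_top_iff_card_eq_finrank_add_one,
      finrank_euclideanSpace, Fintype.card_fin, Fintype.card_coe]
    exact (𝒯.mem_cells.1 K.2).2⟩

theorem cellBasis_apply (K : 𝒯.cells) (i : K.1) : 𝒯.cellBasis K i = i := rfl

theorem simplexOf_cellBasis (K : 𝒯.cells) :
    simplexOf (𝒯.cellBasis K) = convexHull ℝ (K.1 : Set (E d)) := by
  rw [simplexOf]
  congr 1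
  ext x
  simp [cellBasis_apply]

theorem isBarycentric_coord (K : 𝒯.cells) {x : E d} (hx : x ∈ convexHull ℝ (K.1 : Set (E d))) :
    ∃ w, IsBarycentric K.1 x w ∧ ∀ i : K.1, w i = (𝒯.cellBasis K).coord i x := by
  classical
  rw [← simplexOf_cellBasis, mem_simplexOf] at hx
  refine ⟨fun y => if h : y ∈ K.1 then (𝒯.cellBasis K).coord ⟨y, h⟩ x else 0,
    ⟨fun y hy => ?_, fun y hy => dif_neg hy, ?_, ?_⟩, fun i => ?_⟩
  · simp only [dif_pos hy]; exact hx _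
  · rw [← (𝒯.cellBasis K).sum_coord_apply_eq_one x, ← Finset.sum_coe_sort]
    exact Finset.sum_congr rfl fun i _ => dif_pos i.2
  · conv_rhs => rw [← (𝒯.cellBasis K).linear_combination_coord_eq_self x]
    rw [← Finset.sum_coe_sort]
    exact Finset.sum_congr rfl fun i _ => by simp only [dif_pos i.2]; rfl
  · exact dif_pos i.2

theorem interp_eq_sum_coord (K : 𝒯.cells) {x : E d}
    (hx : x ∈ convexHull ℝ (K.1 : Set (E d))) (f : E d → ℝ) :
    𝒯.interp f x = ∑ i : K.1, f i * (𝒯.cellBasis K).coord i x := by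
  obtain ⟨w, hw, hc⟩ := 𝒯.isBarycentric_coord K hx
  rw [𝒯.interp_eq (𝒯.mem_cells.1 K.2).1 hw, ← Finset.sum_coe_sort]
  exact Finset.sum_congr rfl fun i _ => by rw [hc]

theorem affineMap_eq_sum_coord {ι : Type*} [Fintype ι] (b : AffineBasis ι ℝ (E d))
    (A : E d →ᵃ[ℝ] ℝ) (x : E d) : A x = ∑ i, A (b i) * b.coord i x := by
  have hA : ∀ y, A y = A.linear y + A 0 := fun y => by simpa using A.map_vadd 0 y
  conv_lhs => rw [← b.linear_combination_coord_eq_self x, hA, map_sum]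
  have : A 0 = ∑ i, A 0 * b.coord i x := by
    rw [← Finset.mul_sum, b.sum_coord_apply_eq_one, mul_one]
  rw [this, ← Finset.sum_add_distrib]
  refine Finset.sum_congr rfl fun i _ => ?_
  rw [map_smul, hA (b i), smul_eq_mul]
  ring

theorem Vh_eq_sum_coord (v : 𝒯.Vh) (K : 𝒯.cells) {x : E d}
    (hx : x ∈ convexHull ℝ (K.1 : Set (E d))) :
    (v : E d → ℝ) x = ∑ i : K.1, (v : E d → ℝ) i * (𝒯.cellBasis K).coord i x := by
  obtain ⟨A, hA⟩ := v.2.2.2 K.1 K.2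
  rw [hA hx, affineMap_eq_sum_coord (𝒯.cellBasis K)]
  refine Finset.sum_congr rfl fun i _ => ?_
  rw [hA (subset_convexHull ℝ _ i.2), cellBasis_apply]

theorem measurableSet_cell (K : Finset (E d)) : MeasurableSet (convexHull ℝ (K : Set (E d))) :=
  (K.finite_toSet.isCompact_convexHull (𝕜 := ℝ)).isClosed.measurableSet

/-- The cells partition the cube up to null sets. -/
theorem restrict_cube : volume.restrict (cube d L) =
    ∑ K : 𝒯.cells, volume.restrict (convexHull ℝ (K.1 : Set (E d))) := by
  classical
  have h1 : cube d L =ᵐ[volume] ⋃ K : 𝒯.cells, convexHull ℝ (K.1 : Set (E d)) := by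
    refine (convex_cube.addHaar_frontier volume |> closure_ae_eq_of_null_frontier).symm.trans ?_
    rw [← 𝒯.space_eq]
    refine Filter.eventuallyLE_antisymm_iff.2 ⟨?_, ?_⟩
    -- Points outside all cells lie in one of finitely many simplices with at most `d` vertices,
    -- each contained in a proper affine subspace.
    · refine ae_le_set.2 (measure_mono_null (t := ⋃ s ∈ {s ∈ 𝒯.complex.faces | s.card ≤ d},
        convexHull ℝ (s : Set (E d))) ?_ ?_)
      · rintro x ⟨hx, hx'⟩
        obtain ⟨s, hs, hxs⟩ := Geometry.SimplicialComplex.mem_space_iff.1 hx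
        refine mem_biUnion (⟨hs, ?_⟩ : s ∈ {s ∈ 𝒯.complex.faces | s.card ≤ d}) hxs
        have hc := (𝒯.complex.indep hs).card_le_finrank_succ
        have hc' := (vectorSpan ℝ (range ((↑) : s → E d))).finrank_le
        rw [finrank_euclideanSpace, Fintype.card_fin] at hc'
        rw [Fintype.card_coe] at hc
        by_contra hlt
        exact hx' (mem_iUnion.2 ⟨⟨s, 𝒯.mem_cells.2 ⟨hs, by omega⟩⟩, hxs⟩)
      · exact (measure_biUnion_null_iff (𝒯.finite.subset (sep_subset _ _)).countable).2
          fun s hs => volume_convexHull_eq_zero hs.2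
    · refine Filter.Eventually.of_forall fun x hx => ?_
      obtain ⟨K, hK⟩ := mem_iUnion.1 hx
      exact Geometry.SimplicialComplex.mem_space_iff.2 ⟨K.1, (𝒯.mem_cells.1 K.2).1, hK⟩
  rw [Measure.restrict_congr_set h1, Measure.restrict_iUnion_ae, Measure.sum_fintype]
  · intro K K' hKK
    have hne : K.1 ≠ K'.1 := fun h => hKK (Subtype.ext h)
    have hK := 𝒯.mem_cells.1 K.2
    have hK' := 𝒯.mem_cells.1 K'.2
    refine measure_mono_null (𝒯.complex.inter_subset_convexHull hK.1 hK'.1) ?_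
    rw [← Finset.coe_inter]
    refine volume_convexHull_eq_zero ?_
    -- Distinct cells meet in a face with fewer than `d + 1` vertices, hence in a null set.
    have : (K.1 ∩ K'.1).card < K.1.card := Finset.card_lt_card
      (Finset.inter_subset_left.ssubset_of_ne fun h =>
        hne (Finset.eq_of_subset_of_card_le (Finset.inter_eq_left.1 h) (by rw [hK.2, hK'.2])))
    omega
  · exact fun K => (measurableSet_cell K.1).nullMeasurableSet

theorem setIntegral_cube {F : E d → ℝ}
    (hF : ∀ K : 𝒯.cells, IntegrableOn F (convexHull ℝ (K.1 : Set (E d)))) :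
    ∫ x in cube d L, F x = ∑ K : 𝒯.cells, ∫ x in convexHull ℝ (K.1 : Set (E d)), F x := by
  rw [𝒯.restrict_cube, integral_finsetSum_measure fun K _ => hF K]

theorem ae_cube_iff {p : E d → Prop} : (∀ᵐ x ∂volume.restrict (cube d L), p x) ↔
    ∀ K : 𝒯.cells, ∀ᵐ x ∂volume.restrict (convexHull ℝ (K.1 : Set (E d))), p x := by
  rw [𝒯.restrict_cube, ae_finsetSum_measure_iff]
  simp

/-- The gradient of a finite element function is bounded almost everywhere. -/
theorem exists_gradient_bound (v : 𝒯.Vh) :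
    ∃ B : ℝ, ∀ᵐ x ∂volume.restrict (cube d L), ‖gradient (v : E d → ℝ) x‖ ≤ B := by
  have hex : ∀ K : 𝒯.cells, ∃ A : E d →ᴬ[ℝ] ℝ,
      EqOn (v : E d → ℝ) A (convexHull ℝ (K.1 : Set (E d))) := fun K =>
    let ⟨A, hA⟩ := v.2.2.2 K.1 K.2
    ⟨⟨A, A.continuous_of_finiteDimensional⟩, hA⟩
  choose A hA using hex
  refine ⟨∑ K : 𝒯.cells, ‖(A K).contLinear‖, 𝒯.ae_cube_iff.2 fun K => ?_⟩
  -- Off the null frontier the function agrees with an affine map on a neighbourhood, so its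
  -- gradient is that of the affine map.
  have hfr : ∀ᵐ x, x ∉ frontier (convexHull ℝ (K.1 : Set (E d))) :=
    measure_eq_zero_iff_ae_notMem.1 ((convex_convexHull ℝ _).addHaar_frontier volume)
  rw [ae_restrict_iff' (measurableSet_cell K.1)]
  filter_upwards [hfr] with x hx hxK
  have hint : x ∈ interior (convexHull ℝ (K.1 : Set (E d))) := by
    by_contra h
    exact hx ⟨subset_closure hxK, h⟩
  have hev : (v : E d → ℝ) =ᶠ[nhds x] A K :=
    Filter.eventuallyEq_of_mem (mem_interior_iff_mem_nhds.1 hint) (hA K)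
  rw [gradient, hev.fderiv_eq, LinearIsometryEquiv.norm_map,
    (A K).hasFDerivAt.fderiv]
  exact Finset.single_le_sum (f := fun K => ‖(A K).contLinear‖)
    (fun _ _ => norm_nonneg _) (Finset.mem_univ K)

theorem memLp_gradient (v : 𝒯.Vh) :
    MemLp (gradient (v : E d → ℝ)) 2 (volume.restrict (cube d L)) := by
  obtain ⟨B, hB⟩ := 𝒯.exists_gradient_bound v
  refine MemLp.of_bound ?_ B hB
  exact ((InnerProductSpace.toDual ℝ (E d)).symm.continuous.measurable.comp
    (measurable_fderiv ℝ (v : E d → ℝ))).aestronglyMeasurable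

end Triangulation

end Mesh

namespace Triangulation

/-! ### Finite element functions: dissipativity of the drift, norms, measurability. -/

section FiniteElement

variable {d : ℕ} {L : ℝ} (𝒯 : Triangulation d L)

theorem coeFn_toL2 (v : 𝒯.Vh) : (𝒯.toL2 v : E d → ℝ) =ᵐ[volume.restrict (cube d L)] v :=
  MemLp.coeFn_toLp _

theorem ip_eq_inner (f : L2 d L) (v : 𝒯.Vh) : ip L (f : E d → ℝ) (v : E d → ℝ) = ⟪f, 𝒯.toL2 v⟫ := by
  rw [L2.inner_def, ip]
  refine integral_congr_ae ?_
  filter_upwards [𝒯.coeFn_toL2 v] with x hx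
  rw [hx, real_inner_eq_re_inner ℝ]
  simp [mul_comm]

theorem ip_congr_left {f g : E d → ℝ} (h : f =ᵐ[volume.restrict (cube d L)] g) (v : E d → ℝ) :
    ip L f v = ip L g v :=
  integral_congr_ae (by filter_upwards [h] with x hx; rw [hx])

theorem toL2_add (v w : 𝒯.Vh) : 𝒯.toL2 (v + w) = 𝒯.toL2 v + 𝒯.toL2 w := rfl

theorem toL2_smul (r : ℝ) (v : 𝒯.Vh) : 𝒯.toL2 (r • v) = r • 𝒯.toL2 v := rfl

theorem toL2_sub (v w : 𝒯.Vh) : 𝒯.toL2 (v - w) = 𝒯.toL2 v - 𝒯.toL2 w := rfl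

theorem ip_Vh_eq_inner (v w : 𝒯.Vh) :
    ip L (v : E d → ℝ) (w : E d → ℝ) = ⟪𝒯.toL2 v, 𝒯.toL2 w⟫ := by
  rw [← ip_eq_inner]
  exact (ip_congr_left (𝒯.coeFn_toL2 v) _).symm

theorem integrableOn_cube {f : E d → ℝ} (hf : Continuous f) : IntegrableOn f (cube d L) :=
  (hf.continuousOn.integrableOn_compact (cube_isBounded d L).isCompact_closure).mono_set
    subset_closure

/-- The interpolated nonlinearity is dissipative on the finite element space. -/
theorem ip_interp_le {q : ℕ} (hq : Odd q) {γ : ℝ} (hγ0 : 0 ≤ γ)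
    (hγ : ∀ u : Fin (d + 1) → ℝ,
      γ * ∑ i, u i ^ (q + 1) ≤ ∑ i, u i ^ (q + 1) + (∑ i, u i ^ q) * ∑ i, u i) (z : 𝒯.Vh) :
    ip L (𝒯.interp fun x => (z : E d → ℝ) x - (z : E d → ℝ) x ^ q) (z : E d → ℝ) ≤
      ∫ x in cube d L, (z : E d → ℝ) x ^ 2 -
        γ / (d + 2) * (z : E d → ℝ) x ^ (q + 1) := by
  classical
  have hz := z.2.1
  have hcell : ∀ K : 𝒯.cells, ∀ x ∈ convexHull ℝ (K.1 : Set (E d)),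
      𝒯.interp (fun x => (z : E d → ℝ) x - (z : E d → ℝ) x ^ q) x * (z : E d → ℝ) x =
      (z : E d → ℝ) x ^ 2 - (∑ i : K.1, (z : E d → ℝ) i ^ q * (𝒯.cellBasis K).coord i x) *
        ∑ i : K.1, (z : E d → ℝ) i * (𝒯.cellBasis K).coord i x := fun K x hx => by
    rw [𝒯.interp_eq_sum_coord K hx, 𝒯.Vh_eq_sum_coord z K hx]
    simp only [sub_mul, Finset.sum_sub_distrib]
    ring
  have hc : ∀ K : 𝒯.cells, IsCompact (convexHull ℝ (K.1 : Set (E d))) := fun K =>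
    K.1.finite_toSet.isCompact_convexHull (𝕜 := ℝ)
  have hI1 : ∀ K : 𝒯.cells, IntegrableOn (fun x => (z : E d → ℝ) x ^ 2)
      (convexHull ℝ (K.1 : Set (E d))) := fun K =>
    (hz.pow 2).continuousOn.integrableOn_compact (hc K)
  have hI2 : ∀ K : 𝒯.cells, IntegrableOn
      (fun x => γ / (d + 2) * (z : E d → ℝ) x ^ (q + 1))
      (convexHull ℝ (K.1 : Set (E d))) := fun K =>
    ((hz.pow _).const_mul _).continuousOn.integrableOn_compact (hc K)
  have hI3 : ∀ K : 𝒯.cells, IntegrableOn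
      (fun x => (∑ i : K.1, (z : E d → ℝ) i ^ q * (𝒯.cellBasis K).coord i x) *
        ∑ i : K.1, (z : E d → ℝ) i * (𝒯.cellBasis K).coord i x)
      (convexHull ℝ (K.1 : Set (E d))) := fun K => by
    have := integrableOn_simplexOf volume (𝒯.cellBasis K)
      (f := fun c => (∑ i : K.1, (z : E d → ℝ) i ^ q * c i) * ∑ i : K.1, (z : E d → ℝ) i * c i)
      (by fun_prop)
    rwa [simplexOf_cellBasis] at this
  rw [ip, 𝒯.setIntegral_cube fun K => ((hI1 K).sub (hI3 K)).congr_fun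
    (fun x hx => (hcell K x hx).symm) (measurableSet_cell K.1),
    𝒯.setIntegral_cube (F := fun x => (z : E d → ℝ) x ^ 2 -
      γ / (d + 2) * (z : E d → ℝ) x ^ (q + 1)) fun K => (hI1 K).sub (hI2 K)]
  refine Finset.sum_le_sum fun K _ => ?_
  rw [setIntegral_congr_fun (measurableSet_cell K.1) (hcell K),
    integral_sub (hI1 K) (hI3 K), integral_sub (hI1 K) (hI2 K)]
  refine sub_le_sub_left ?_ _
  -- A cell has `d + 1` vertices, so the factor `card + 1` of the mass matrix becomes the `d + 2` of
  -- the statement.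
  have hcard : Fintype.card K.1 = d + 1 := by
    rw [Fintype.card_coe]; exact (𝒯.mem_cells.1 K.2).2
  let e : K.1 ≃ Fin (d + 1) := Fintype.equivFinOfCardEq hcard
  have hγ' : γ * ∑ i : K.1, (z : E d → ℝ) i ^ (q + 1) ≤
      ∑ i : K.1, (z : E d → ℝ) i ^ (q + 1) +
        (∑ i : K.1, (z : E d → ℝ) i ^ q) * ∑ i : K.1, (z : E d → ℝ) i := by
    have := hγ fun j => (z : E d → ℝ) (e.symm j)
    rwa [e.symm.sum_comp (fun i : K.1 => (z : E d → ℝ) i ^ (q + 1)),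
      e.symm.sum_comp (fun i : K.1 => (z : E d → ℝ) i ^ q),
      e.symm.sum_comp (fun i : K.1 => (z : E d → ℝ) i)] at this
  have key := setIntegral_pow_le volume (𝒯.cellBasis K) hq _ hγ' hγ0
  rw [simplexOf_cellBasis, hcard] at key
  refine le_of_eq_of_le ?_ key
  rw [integral_const_mul]
  push_cast
  rw [add_assoc, one_add_one_eq_two]
  congr 1
  exact setIntegral_congr_fun (measurableSet_cell K.1) fun x hx => by
    simp only [𝒯.Vh_eq_sum_coord z K hx]

/-- Half of the coercive term absorbs `z ^ 2` by Young's inequality at the price of a constant times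
the volume of the cube; the other half remains as dissipation. -/
theorem ip_interp_le_const {q : ℕ} (hq : Odd q) (hq3 : 3 ≤ q) {γ : ℝ} (hγ0 : 0 < γ)
    (hγ : ∀ u : Fin (d + 1) → ℝ,
      γ * ∑ i, u i ^ (q + 1) ≤ ∑ i, u i ^ (q + 1) + (∑ i, u i ^ q) * ∑ i, u i) (z : 𝒯.Vh) :
    ip L (𝒯.interp fun x => (z : E d → ℝ) x - (z : E d → ℝ) x ^ q) (z : E d → ℝ) ≤
      (1 + (γ / (2 * (d + 2)))⁻¹) * volume.real (cube d L) -
        γ / (2 * (d + 2)) * ∫ x in cube d L, (z : E d → ℝ) x ^ (q + 1) := by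
  refine (𝒯.ip_interp_le hq hγ0.le hγ z).trans ?_
  have hz := z.2.1
  have h1 : ∫ x in cube d L, ((1 + (γ / (2 * (d + 2)))⁻¹) -
      γ / (2 * (d + 2)) * (z : E d → ℝ) x ^ (q + 1)) =
      (1 + (γ / (2 * (d + 2)))⁻¹) * volume.real (cube d L) -
        γ / (2 * (d + 2)) * ∫ x in cube d L, (z : E d → ℝ) x ^ (q + 1) := by
    rw [integral_sub (integrableOn_cube continuous_const)
      (integrableOn_cube (f := fun x => γ / (2 * (d + 2)) * (z : E d → ℝ) x ^ (q + 1))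
        (by fun_prop)), integral_const_mul, setIntegral_const]
    rw [smul_eq_mul, mul_comm (volume.real _)]
  rw [← h1]
  refine integral_mono (integrableOn_cube (by fun_prop)) (integrableOn_cube (by fun_prop))
    fun x => ?_
  have := sq_le_add_mul_pow hq hq3 (by positivity : 0 < γ / (2 * ((d : ℝ) + 2)))
    ((z : E d → ℝ) x)
  have e : γ / ((d : ℝ) + 2) = 2 * (γ / (2 * ((d : ℝ) + 2))) := by
    field_simp
  simp only [e]
  linarith

theorem lpNorm_two_eq (v : 𝒯.Vh) : lpNorm L 2 (v : E d → ℝ) = ‖𝒯.toL2 v‖ₑ :=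
  (Lp.enorm_toLp (𝒯.Vh_memLp v)).symm

theorem lpNorm_two_sq (v : 𝒯.Vh) :
    lpNorm L 2 (v : E d → ℝ) ^ 2 = ENNReal.ofReal (‖𝒯.toL2 v‖ ^ 2) := by
  rw [lpNorm_two_eq, ENNReal.ofReal_pow (norm_nonneg _), ofReal_norm]

theorem lpNorm_gradient_sq (v : 𝒯.Vh) :
    lpNorm L 2 (gradient (v : E d → ℝ)) ^ 2 =
      ENNReal.ofReal (gip L (v : E d → ℝ) (v : E d → ℝ)) := by
  have h : gip L (v : E d → ℝ) (v : E d → ℝ) = ‖(𝒯.memLp_gradient v).toLp‖ ^ 2 := by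
    rw [← real_inner_self_eq_norm_sq, L2.inner_def, gip]
    refine integral_congr_ae ?_
    filter_upwards [(𝒯.memLp_gradient v).coeFn_toLp] with x hx
    rw [hx]
  rw [h, ENNReal.ofReal_pow (norm_nonneg _), ofReal_norm, Lp.enorm_toLp, lpNorm]

theorem gip_self_nonneg (v : E d → ℝ) : 0 ≤ gip L v v :=
  integral_nonneg fun _ => real_inner_self_nonneg

theorem lpNorm_pow {q : ℕ} (hq : Odd q) (v : 𝒯.Vh) :
    lpNorm L (q + 1) (v : E d → ℝ) ^ (q + 1) =
      ENNReal.ofReal (∫ x in cube d L, (v : E d → ℝ) x ^ (q + 1)) := by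
  have h := eLpNorm_nnreal_pow_eq_lintegral (μ := volume.restrict (cube d L))
    (f := (v : E d → ℝ)) (p := (q + 1 : ℝ≥0)) (by positivity)
  have he : (((q + 1 : ℝ≥0) : ℝ)) = ((q + 1 : ℕ) : ℝ) := by push_cast; rfl
  rw [he] at h
  simp only [ENNReal.rpow_natCast] at h
  have hv := v.2.1
  rw [lpNorm, ofReal_integral_eq_lintegral_ofReal
    (integrableOn_cube (f := fun x => (v : E d → ℝ) x ^ (q + 1)) (by fun_prop))
    (Filter.Eventually.of_forall fun x => hq.add_one.pow_nonneg _)]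
  refine Eq.trans ?_ (h.trans ?_)
  · norm_num
  · refine lintegral_congr fun x => ?_
    rw [← hq.add_one.pow_abs, ENNReal.ofReal_pow (abs_nonneg _), ← Real.norm_eq_abs, ofReal_norm]

theorem setIntegral_pow_nonneg {q : ℕ} (hq : Odd q) (v : E d → ℝ) :
    0 ≤ ∫ x in cube d L, v x ^ (q + 1) :=
  integral_nonneg fun _ => hq.add_one.pow_nonneg _

theorem toL2_eq_zero_of_vertices {v : 𝒯.Vh} (h : ∀ a : 𝒯.vertices, (v : E d → ℝ) a = 0) :
    𝒯.toL2 v = 0 := by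
  refine (Lp.eq_zero_iff_ae_eq_zero).2 ((𝒯.coeFn_toL2 v).trans (𝒯.ae_cube_iff.2 fun K => ?_))
  refine (ae_restrict_iff' (measurableSet_cell K.1)).2 (Filter.Eventually.of_forall fun x hx => ?_)
  rw [𝒯.Vh_eq_sum_coord v K hx]
  refine Finset.sum_eq_zero fun i _ => ?_
  rw [h ⟨i, 𝒯.mem_vertices.2 ⟨K.1, (𝒯.mem_cells.1 K.2).1, i.2⟩⟩, zero_mul]

/-- The `L²` class of a finite element function is a linear function of its nodal values. -/
theorem exists_toL2_eq_comp : ∃ Φ : (𝒯.vertices → ℝ) →ₗ[ℝ] L2 d L,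
    ∀ v : 𝒯.Vh, 𝒯.toL2 v = Φ fun a => (v : E d → ℝ) a := by
  let ev : 𝒯.Vh →ₗ[ℝ] (𝒯.vertices → ℝ) :=
    { toFun := fun v a => (v : E d → ℝ) a
      map_add' := fun _ _ => rfl
      map_smul' := fun _ _ => rfl }
  let ι : 𝒯.Vh →ₗ[ℝ] L2 d L :=
    { toFun := 𝒯.toL2
      map_add' := 𝒯.toL2_add
      map_smul' := 𝒯.toL2_smul }
  -- A linear section over the range of nodal evaluation, extended to all nodal vectors. The choice
  -- is harmless, because equal nodal values give equal `L²` classes.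
  obtain ⟨s, hs⟩ := ev.rangeRestrict.exists_rightInverse_of_surjective ev.range_rangeRestrict
  obtain ⟨Φ, hΦ⟩ := LinearMap.exists_extend (ι ∘ₗ s)
  refine ⟨Φ, fun v => ?_⟩
  have h1 : Φ (ev v) = 𝒯.toL2 (s (ev.rangeRestrict v)) := LinearMap.congr_fun hΦ (ev.rangeRestrict v)
  have h2 : ev (s (ev.rangeRestrict v)) = ev v :=
    congrArg Subtype.val (LinearMap.congr_fun hs (ev.rangeRestrict v))
  refine Eq.trans ?_ h1.symm
  refine sub_eq_zero.1 ?_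
  rw [← toL2_sub]
  exact 𝒯.toL2_eq_zero_of_vertices fun a => sub_eq_zero.2 (congrFun h2 a).symm

/-- The map factors through finitely many nodal values, each a real random variable, followed by a
linear map that is continuous because its domain is finite-dimensional. -/
theorem stronglyMeasurable_toL2 {Ω : Type*} {m : MeasurableSpace Ω} {u : Ω → 𝒯.Vh}
    (hu : ∀ x, Measurable fun ω => (u ω : E d → ℝ) x) :
    StronglyMeasurable fun ω => 𝒯.toL2 (u ω) := by
  obtain ⟨Φ, hΦ⟩ := 𝒯.exists_toL2_eq_comp
  simp only [hΦ]
  have h : Measurable fun ω (a : 𝒯.vertices) => (u ω : E d → ℝ) a :=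
    measurable_pi_lambda _ fun a => hu a
  exact Φ.continuous_of_finiteDimensional.comp_stronglyMeasurable h.stronglyMeasurable

end FiniteElement

end Triangulation

/-! ### Moments of Gaussian increments. -/

section GaussianMoments

theorem integrable_pow_gaussianReal (μ : ℝ) (v : ℝ≥0) (k : ℕ) :
    Integrable (fun x => x ^ k) (gaussianReal μ v) := by
  have h := (memLp_id_gaussianReal (μ := μ) (v := v) (k : ℝ≥0)).integrable_norm_pow' (p := k)
  refine (integrable_norm_iff (by fun_prop)).1 ?_
  simpa only [norm_pow, id_eq] using h

theorem integral_sq_gaussianReal (v : ℝ≥0) : ∫ x, x ^ 2 ∂gaussianReal 0 v = v := by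
  have h := variance_fun_id_gaussianReal (μ := 0) (v := v)
  rw [variance_eq_integral measurable_id'.aemeasurable] at h
  simpa using h

/-- The fourth moment of the standard normal distribution. -/
noncomputable def stdFourthMoment : ℝ := ∫ x, x ^ 4 ∂gaussianReal 0 1

theorem stdFourthMoment_nonneg : 0 ≤ stdFourthMoment :=
  integral_nonneg fun x => by positivity

/-- Scaling by `√v`. Only the order `v ^ 2` matters later, so the standard fourth moment is never
evaluated. -/
theorem integral_pow_four_gaussianReal (v : ℝ≥0) :
    ∫ x, x ^ 4 ∂gaussianReal 0 v = v ^ 2 * stdFourthMoment := by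
  have h := gaussianReal_map_const_mul (μ := 0) (v := 1) (√(v : ℝ))
  have hv : (.mk (√(v : ℝ) ^ 2) (sq_nonneg _) * 1 : ℝ≥0) = v := by
    ext; simp
  rw [mul_zero, hv] at h
  rw [← h, integral_map (by fun_prop) (by fun_prop), stdFourthMoment, ← integral_const_mul]
  congr 1
  funext x
  have : √(v : ℝ) ^ 2 = v := Real.sq_sqrt v.2
  linear_combination (x ^ 4 * (√(v : ℝ) ^ 2 + v)) * this

theorem integral_sq_sub_gaussianReal (v : ℝ≥0) :
    ∫ x, (x ^ 2 - v) ∂gaussianReal 0 v = 0 := by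
  rw [integral_sub (integrable_pow_gaussianReal 0 v 2) (integrable_const _),
    integral_sq_gaussianReal]
  simp

theorem integrable_sq_sub_sq_gaussianReal (v : ℝ≥0) :
    Integrable (fun x : ℝ => (x ^ 2 - v) ^ 2) (gaussianReal 0 v) := by
  have := (((integrable_pow_gaussianReal 0 v 4).sub
    ((integrable_pow_gaussianReal 0 v 2).const_mul (2 * v))).add
    (integrable_const ((v : ℝ) ^ 2)))
  refine this.congr (Filter.Eventually.of_forall fun x => ?_)
  simp only [Pi.add_apply, Pi.sub_apply]
  ring

theorem integral_sq_sub_sq_gaussianReal_le (v : ℝ≥0) :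
    ∫ x, (x ^ 2 - v) ^ 2 ∂gaussianReal 0 v ≤ v ^ 2 * stdFourthMoment := by
  have h4 := integrable_pow_gaussianReal 0 v 4
  have h2 := (integrable_pow_gaussianReal 0 v 2).const_mul (2 * (v : ℝ))
  have e : ∀ x : ℝ, (x ^ 2 - v) ^ 2 = x ^ 4 - 2 * v * x ^ 2 + (v : ℝ) ^ 2 := fun x => by ring
  simp only [e]
  have h42 : Integrable (fun x : ℝ => x ^ 4 - 2 * v * x ^ 2) (gaussianReal 0 v) := h4.sub h2
  rw [integral_add h42 (integrable_const _), integral_sub h4 h2, integral_const_mul,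
    integral_sq_gaussianReal, integral_pow_four_gaussianReal]
  simp
  nlinarith [sq_nonneg (v : ℝ)]

end GaussianMoments

/-! ### Products of past variables with independent increments. -/

section Independence

variable {Ω : Type*} {m mΩ : MeasurableSpace Ω} {P : Measure Ω}

/-- A random variable that is measurable with respect to the past, times a function of an increment
that is independent of the past. -/
theorem integrable_mul_of_indep {B : Ω → ℝ} {ν : Measure ℝ} (hB : HasLaw B ν P)
    (hind : Indep (MeasurableSpace.comap B inferInstance) m P) {X : Ω → ℝ}
    (hX : StronglyMeasurable[m] X) (hXi : Integrable X P) {f : ℝ → ℝ} (hf : Measurable f)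
    (hfi : Integrable f ν) : Integrable (fun ω => X ω * f (B ω)) P := by
  have hi : IndepFun X (fun ω => f (B ω)) P := by
    rw [IndepFun_iff_Indep]
    refine indep_of_indep_of_le_left (indep_of_indep_of_le_right hind.symm ?_) hX.measurable.comap_le
    rw [show (fun ω => f (B ω)) = f ∘ B from rfl, ← MeasurableSpace.comap_comp]
    exact MeasurableSpace.comap_mono hf.comap_le
  have hfB : Integrable (fun ω => f (B ω)) P := by
    rw [← hB.map_eq] at hfi
    exact hfi.comp_aemeasurable hB.aemeasurable
  exact hi.integrable_mul hXi hfB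

theorem integral_mul_of_indep (hm : m ≤ mΩ) {B : Ω → ℝ} {ν : Measure ℝ} (hB : HasLaw B ν P)
    (hind : Indep (MeasurableSpace.comap B inferInstance) m P) {X : Ω → ℝ}
    (hX : StronglyMeasurable[m] X) {f : ℝ → ℝ} (hf : Measurable f) :
    ∫ ω, X ω * f (B ω) ∂P = (∫ ω, X ω ∂P) * ∫ x, f x ∂ν := by
  have hi : IndepFun X (fun ω => f (B ω)) P := by
    rw [IndepFun_iff_Indep]
    refine indep_of_indep_of_le_left (indep_of_indep_of_le_right hind.symm ?_) hX.measurable.comap_le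
    rw [show (fun ω => f (B ω)) = f ∘ B from rfl, ← MeasurableSpace.comap_comp]
    exact MeasurableSpace.comap_mono hf.comap_le
  rw [hi.integral_fun_mul_eq_mul_integral (hX.mono hm).aestronglyMeasurable
    (hf.comp_aemeasurable hB.aemeasurable).aestronglyMeasurable]
  congr 1
  exact hB.integral_comp hf.aestronglyMeasurable

end Independence

/-! ### The energy balance of one Milstein step in a Hilbert space. -/

section MilsteinStep

variable {H : Type*} [NormedAddCommGroup H] [InnerProductSpace ℝ H]

theorem NoiseAssumptions.nonneg {G : H → H} {DG : H → H →L[ℝ] H} {c : ℝ}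
    (h : NoiseAssumptions G DG c) : 0 ≤ c := by
  obtain ⟨D2G, -, hb⟩ := h.deriv_bound
  exact (add_nonneg (norm_nonneg (DG 0)) (norm_nonneg (D2G 0))).trans (hb 0 0)

theorem NoiseAssumptions.norm_deriv_le {G : H → H} {DG : H → H →L[ℝ] H} {c : ℝ}
    (h : NoiseAssumptions G DG c) (u : H) : ‖DG u‖ ≤ c := by
  obtain ⟨D2G, -, hb⟩ := h.deriv_bound
  linarith [norm_nonneg (D2G 0), hb u 0]

theorem NoiseAssumptions.continuous {G : H → H} {DG : H → H →L[ℝ] H} {c : ℝ}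
    (h : NoiseAssumptions G DG c) : Continuous G :=
  (LipschitzWith.of_dist_le' (K := c) fun v w => by
    simpa only [dist_eq_norm] using h.lipschitz v w).continuous

theorem NoiseAssumptions.norm_sq_le {G : H → H} {DG : H → H →L[ℝ] H} {c : ℝ}
    (h : NoiseAssumptions G DG c) (y : H) : ‖G y‖ ^ 2 ≤ 2 * c ^ 2 * (‖y‖ ^ 2 + 1) := by
  have h1 := pow_le_pow_left₀ (norm_nonneg _) (h.growth y) 2
  nlinarith [sq_nonneg c, sq_nonneg (‖y‖ - 1), mul_nonneg (sq_nonneg c) (sq_nonneg (‖y‖ - 1))]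

theorem NoiseAssumptions.norm_correction_sq_le {G : H → H} {DG : H → H →L[ℝ] H} {c : ℝ}
    (h : NoiseAssumptions G DG c) (y : H) :
    ‖DG y (G y)‖ ^ 2 ≤ c ^ 2 * (2 * c ^ 2 * (‖y‖ ^ 2 + 1)) := by
  have h1 : ‖DG y (G y)‖ ≤ c * ‖G y‖ := ((DG y).le_opNorm _).trans
    (mul_le_mul_of_nonneg_right (h.norm_deriv_le y) (norm_nonneg _))
  have h2 := pow_le_pow_left₀ (norm_nonneg _) h1 2
  rw [mul_pow] at h2
  exact h2.trans (mul_le_mul_of_nonneg_left (h.norm_sq_le y) (sq_nonneg c))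

/-- `DG` is a Gateaux derivative with no measurability of its own. Along the direction `G (Y ω)` it
is the limit of difference quotients of the continuous map `G` with steps `1 / (n + 1)`, and these
are strongly measurable. -/
theorem NoiseAssumptions.stronglyMeasurable_correction {Ω : Type*} {m : MeasurableSpace Ω}
    {G : H → H} {DG : H → H →L[ℝ] H} {c : ℝ} (h : NoiseAssumptions G DG c) {Y : Ω → H}
    (hY : StronglyMeasurable Y) : StronglyMeasurable fun ω => DG (Y ω) (G (Y ω)) := by
  have hG : StronglyMeasurable fun ω => G (Y ω) := h.continuous.comp_stronglyMeasurable hY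
  have ht : Filter.Tendsto (fun n : ℕ => 1 / ((n : ℝ) + 1)) Filter.atTop (nhdsWithin 0 (Ioi 0)) :=
    tendsto_nhdsWithin_iff.2 ⟨tendsto_one_div_add_atTop_nhds_zero_nat,
      Filter.Eventually.of_forall fun n => by simp only [mem_Ioi]; positivity⟩
  refine stronglyMeasurable_of_tendsto Filter.atTop
    (f := fun (n : ℕ) ω => (1 / ((n : ℝ) + 1))⁻¹ •
      (G (Y ω + (1 / ((n : ℝ) + 1)) • G (Y ω)) - G (Y ω))) (fun n => ?_) ?_
  · exact ((h.continuous.comp_stronglyMeasurable (hY.add (hG.const_smul _))).sub hG).const_smul _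
  · exact tendsto_pi_nhds.2 fun ω =>
      ((h.gateaux (Y ω) (G (Y ω))).tendsto_slope_zero_right).comp ht

/-- Young's inequalities for the noise terms of the energy identity. -/
theorem energy_le {y z g k : H} {B K A r : ℝ}
    (h : ⟪z - y, z⟫ + A ≤ K + ⟪g, z⟫ * B + 1 / 2 * ⟪k, z⟫ * r) :
    ‖z‖ ^ 2 + 1 / 2 * ‖z - y‖ ^ 2 + 2 * A ≤ ‖y‖ ^ 2 + 2 * K + 2 * (⟪g, y⟫ * B) + ⟪k, y⟫ * r +
      4 * (‖g‖ ^ 2 * B ^ 2) + ‖k‖ ^ 2 * r ^ 2 := by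
  -- The parts paired with `y` keep their form, since their expectations vanish; only the parts
  -- paired with `z - y` are estimated.
  have e1 : ⟪g, z⟫ = ⟪g, y⟫ + ⟪g, z - y⟫ := by rw [inner_sub_right]; ring
  have e2 : ⟪k, z⟫ = ⟪k, y⟫ + ⟪k, z - y⟫ := by rw [inner_sub_right]; ring
  have e3 : 2 * ⟪z - y, z⟫ = ‖z‖ ^ 2 - ‖y‖ ^ 2 + ‖z - y‖ ^ 2 := by
    rw [norm_sub_sq_real, inner_sub_left, real_inner_self_eq_norm_sq, real_inner_comm y z]
    ring
  -- After doubling the hypothesis, the two Young inequalities cost `2 · 1/8 + 1/4 = 1/2` of `‖z -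
  -- y‖ ^ 2`, half of what the polarization identity `e3` supplies.
  have h1 : ⟪g, z - y⟫ * B ≤ 1 / 8 * ‖z - y‖ ^ 2 + 2 * (‖g‖ ^ 2 * B ^ 2) := by
    have hc : ⟪g, z - y⟫ ^ 2 ≤ (‖g‖ * ‖z - y‖) ^ 2 :=
      sq_le_sq' (by linarith [neg_abs_le ⟪g, z - y⟫, abs_real_inner_le_norm g (z - y)])
        (real_inner_le_norm _ _)
    have h2 : |⟪g, z - y⟫ * B| ≤ ‖z - y‖ * (‖g‖ * |B|) := by
      rw [abs_mul]
      calc _ ≤ ‖g‖ * ‖z - y‖ * |B| :=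
            mul_le_mul_of_nonneg_right (abs_real_inner_le_norm _ _) (abs_nonneg _)
        _ = _ := by ring
    have h3 := le_abs_self (⟪g, z - y⟫ * B)
    have h4 : (‖g‖ * |B|) ^ 2 = ‖g‖ ^ 2 * B ^ 2 := by rw [mul_pow, sq_abs]
    nlinarith [sq_nonneg (‖z - y‖ - 4 * (‖g‖ * |B|))]
  have h1' : ⟪k, z - y⟫ * r ≤ 1 / 4 * ‖z - y‖ ^ 2 + ‖k‖ ^ 2 * r ^ 2 := by
    have h2 : |⟪k, z - y⟫ * r| ≤ ‖z - y‖ * (‖k‖ * |r|) := by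
      rw [abs_mul]
      calc _ ≤ ‖k‖ * ‖z - y‖ * |r| :=
            mul_le_mul_of_nonneg_right (abs_real_inner_le_norm _ _) (abs_nonneg _)
        _ = _ := by ring
    have h3 := le_abs_self (⟪k, z - y⟫ * r)
    have h4 : (‖k‖ * |r|) ^ 2 = ‖k‖ ^ 2 * r ^ 2 := by rw [mul_pow, sq_abs]
    nlinarith [sq_nonneg (‖z - y‖ - 2 * (‖k‖ * |r|))]
  rw [e1, e2] at h
  nlinarith

variable {Ω : Type*} {m mΩ : MeasurableSpace Ω} {P : Measure Ω} [IsProbabilityMeasure P]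

/-- The growth constant of the second moments in the Milstein scheme. -/
noncomputable def growthConst (c T K : ℝ) : ℝ := 2 * K + 8 * c ^ 2 + 2 * T * stdFourthMoment * c ^ 4

theorem growthConst_nonneg {c T K : ℝ} (hT : 0 ≤ T) (hK : 0 ≤ K) : 0 ≤ growthConst c T K := by
  have := stdFourthMoment_nonneg
  unfold growthConst
  positivity

/-- The expectation of the right-hand side of the energy inequality. -/
theorem lintegral_energy_le (hm : m ≤ mΩ) {G : H → H} {DG : H → H →L[ℝ] H} {c : ℝ}
    (hG : NoiseAssumptions G DG c) {Y : Ω → H} (hY : StronglyMeasurable[m] Y) {τ : ℝ≥0}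
    {B : Ω → ℝ} (hB : HasLaw B (gaussianReal 0 τ) P)
    (hind : Indep (MeasurableSpace.comap B inferInstance) m P) {K T : ℝ} (hK : 0 ≤ K)
    (hτT : τ ≤ T) {R : Ω → ℝ}
    (hR : R = fun ω => ‖Y ω‖ ^ 2 + 2 * (τ * K) + 2 * (⟪G (Y ω), Y ω⟫ * B ω) +
      ⟪DG (Y ω) (G (Y ω)), Y ω⟫ * (B ω ^ 2 - τ) + 4 * (‖G (Y ω)‖ ^ 2 * B ω ^ 2) +
      ‖DG (Y ω) (G (Y ω))‖ ^ 2 * (B ω ^ 2 - τ) ^ 2)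
    (hR0 : 0 ≤ᵐ[P] R) :
    ∫⁻ ω, ENNReal.ofReal (R ω) ∂P ≤ ∫⁻ ω, ENNReal.ofReal (‖Y ω‖ ^ 2) ∂P +
      ENNReal.ofReal (τ * growthConst c T K) *
        (∫⁻ ω, ENNReal.ofReal (‖Y ω‖ ^ 2) ∂P + 1) := by
  -- An infinite second moment makes the bound trivial; a finite one makes every term integrable.
  rcases eq_or_ne (∫⁻ ω, ENNReal.ofReal (‖Y ω‖ ^ 2) ∂P) ∞ with htop | htop
  · rw [htop, top_add]; exact le_top
  have hT : 0 ≤ T := τ.2.trans hτT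
  have hc := hG.nonneg
  have hgm : StronglyMeasurable[m] fun ω => G (Y ω) := hG.continuous.comp_stronglyMeasurable hY
  have hkm : StronglyMeasurable[m] fun ω => DG (Y ω) (G (Y ω)) :=
    hG.stronglyMeasurable_correction hY
  have hYm : StronglyMeasurable[m] fun ω => ‖Y ω‖ ^ 2 := hY.norm.pow 2
  have hg2m : StronglyMeasurable[m] fun ω => ‖G (Y ω)‖ ^ 2 := hgm.norm.pow 2
  have hk2m : StronglyMeasurable[m] fun ω => ‖DG (Y ω) (G (Y ω))‖ ^ 2 := hkm.norm.pow 2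
  have hYi : Integrable (fun ω => ‖Y ω‖ ^ 2) P := by
    refine ⟨(hYm.mono hm).aestronglyMeasurable, ?_⟩
    rw [hasFiniteIntegral_iff_ofReal (Filter.Eventually.of_forall fun ω => sq_nonneg _)]
    exact lt_top_iff_ne_top.2 htop
  have hY1 : Integrable (fun ω => ‖Y ω‖ ^ 2 + 1) P := hYi.add (integrable_const 1)
  have hg2 : Integrable (fun ω => ‖G (Y ω)‖ ^ 2) P :=
    (hY1.const_mul (2 * c ^ 2)).mono' (hg2m.mono hm).aestronglyMeasurable
      (Filter.Eventually.of_forall fun ω => by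
        rw [Real.norm_of_nonneg (sq_nonneg _)]; exact hG.norm_sq_le _)
  have hk2 : Integrable (fun ω => ‖DG (Y ω) (G (Y ω))‖ ^ 2) P :=
    ((hY1.const_mul (2 * c ^ 2)).const_mul (c ^ 2)).mono'
      (hk2m.mono hm).aestronglyMeasurable
      (Filter.Eventually.of_forall fun ω => by
        rw [Real.norm_of_nonneg (sq_nonneg _)]; exact hG.norm_correction_sq_le _)
  have hinner : ∀ {Z : Ω → H}, StronglyMeasurable[m] Z → Integrable (fun ω => ‖Z ω‖ ^ 2) P →
      Integrable (fun ω => ⟪Z ω, Y ω⟫) P := fun {Z} hZ hZi =>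
    (hZi.add hYi).mono' ((hZ.inner hY).mono hm).aestronglyMeasurable
      (Filter.Eventually.of_forall fun ω => by
        have := norm_inner_le_norm (𝕜 := ℝ) (Z ω) (Y ω)
        simp only [Pi.add_apply]
        nlinarith [sq_nonneg (‖Z ω‖ - ‖Y ω‖), norm_nonneg (Z ω), norm_nonneg (Y ω)])
  have hgy := hinner hgm hg2
  have hky := hinner hkm hk2
  have i1 : Integrable (fun x : ℝ => x) (gaussianReal 0 τ) := by
    simpa using integrable_pow_gaussianReal 0 τ 1
  have i2 := integrable_pow_gaussianReal 0 τ 2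
  have i3 : Integrable (fun x : ℝ => x ^ 2 - τ) (gaussianReal 0 τ) := i2.sub (integrable_const _)
  have i4 := integrable_sq_sub_sq_gaussianReal τ
  have I1 := (integrable_mul_of_indep hB hind (hgm.inner hY) hgy measurable_id' i1).const_mul 2
  have I2 := integrable_mul_of_indep hB hind (hkm.inner hY) hky (by fun_prop) i3
  have I3 := (integrable_mul_of_indep hB hind hg2m hg2 (by fun_prop) i2).const_mul 4
  have I4 := integrable_mul_of_indep hB hind hk2m hk2 (by fun_prop) i4
  have E1 := integral_mul_of_indep hm hB hind (hgm.inner hY (𝕜 := ℝ)) measurable_id'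
  have E2 := integral_mul_of_indep hm hB hind (hkm.inner hY (𝕜 := ℝ))
    (f := fun x => x ^ 2 - τ) (by fun_prop)
  have E3 := integral_mul_of_indep hm hB hind hg2m
    (f := fun x => x ^ 2) (by fun_prop)
  have E4 := integral_mul_of_indep hm hB hind hk2m
    (f := fun x => (x ^ 2 - τ) ^ 2) (by fun_prop)
  have I0 : Integrable (fun ω => ‖Y ω‖ ^ 2 + 2 * (τ * K)) P := hYi.add (integrable_const _)
  have hRi : Integrable R P := by
    rw [hR]; exact (((I0.add I1).add I2).add I3).add I4
  -- The increment and its centred square have mean zero, so both terms that are inner products with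
  -- `Y` drop out.
  rw [integral_id_gaussianReal, mul_zero] at E1
  rw [integral_sq_sub_gaussianReal, mul_zero] at E2
  rw [integral_sq_gaussianReal] at E3
  have hRE : ∫ ω, R ω ∂P = ∫ ω, ‖Y ω‖ ^ 2 ∂P + 2 * (τ * K) +
      4 * ((∫ ω, ‖G (Y ω)‖ ^ 2 ∂P) * τ) +
      (∫ ω, ‖DG (Y ω) (G (Y ω))‖ ^ 2 ∂P) * ∫ x, (x ^ 2 - τ) ^ 2 ∂gaussianReal 0 τ := by
    have h := integral_add' (((I0.add I1).add I2).add I3) I4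
    rw [integral_add' ((I0.add I1).add I2) I3, integral_add' (I0.add I1) I2, integral_add' I0 I1,
      integral_const_mul, integral_const_mul, E1, E2, E3, E4,
      integral_add hYi (integrable_const _)] at h
    rw [hR]
    refine h.trans ?_
    simp
  have hY0 : 0 ≤ ∫ ω, ‖Y ω‖ ^ 2 ∂P := integral_nonneg fun _ => sq_nonneg _
  have hint1 : ∫ ω, (‖Y ω‖ ^ 2 + 1) ∂P = ∫ ω, ‖Y ω‖ ^ 2 ∂P + 1 := by
    rw [integral_add hYi (integrable_const _)]; simp
  have hgE : ∫ ω, ‖G (Y ω)‖ ^ 2 ∂P ≤ 2 * c ^ 2 * (∫ ω, ‖Y ω‖ ^ 2 ∂P + 1) := by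
    rw [← hint1, ← integral_const_mul]
    exact integral_mono hg2 (hY1.const_mul _) fun ω => hG.norm_sq_le _
  have hkE : ∫ ω, ‖DG (Y ω) (G (Y ω))‖ ^ 2 ∂P ≤
      c ^ 2 * (2 * c ^ 2 * (∫ ω, ‖Y ω‖ ^ 2 ∂P + 1)) := by
    rw [← hint1, ← integral_const_mul, ← integral_const_mul]
    exact integral_mono hk2 ((hY1.const_mul _).const_mul _) fun ω => hG.norm_correction_sq_le _
  have hbound : ∫ ω, R ω ∂P ≤ ∫ ω, ‖Y ω‖ ^ 2 ∂P +
      τ * growthConst c T K * (∫ ω, ‖Y ω‖ ^ 2 ∂P + 1) := by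
    rw [hRE]
    have hκ := stdFourthMoment_nonneg
    have hτ : (0 : ℝ) ≤ τ := τ.2
    -- The Milstein correction is of order `τ ^ 2`; bounding one factor `τ` by `T` gives the last
    -- term of `growthConst`.
    have h1 : (∫ ω, ‖DG (Y ω) (G (Y ω))‖ ^ 2 ∂P) * ∫ x, (x ^ 2 - τ) ^ 2 ∂gaussianReal 0 τ ≤
        c ^ 2 * (2 * c ^ 2 * (∫ ω, ‖Y ω‖ ^ 2 ∂P + 1)) * (τ * T * stdFourthMoment) := by
      refine mul_le_mul hkE ((integral_sq_sub_sq_gaussianReal_le τ).trans ?_)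
        (integral_nonneg fun _ => sq_nonneg _) (by positivity)
      rw [pow_two]
      gcongr
    have h2 := mul_le_mul_of_nonneg_right hgE hτ
    have h3 : 0 ≤ 2 * (τ * K) * ∫ ω, ‖Y ω‖ ^ 2 ∂P := by positivity
    unfold growthConst
    linarith
  have hgc := growthConst_nonneg (c := c) hT hK
  rw [← ofReal_integral_eq_lintegral_ofReal hRi hR0,
    ← ofReal_integral_eq_lintegral_ofReal hYi (Filter.Eventually.of_forall fun _ => sq_nonneg _)]
  refine (ENNReal.ofReal_le_ofReal hbound).trans_eq ?_
  rw [ENNReal.ofReal_add hY0 (by positivity), ENNReal.ofReal_mul (by positivity),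
    ENNReal.ofReal_add hY0 zero_le_one, ENNReal.ofReal_one]

end MilsteinStep

/-! ### Discrete Gronwall inequality in `ℝ≥0∞`. -/

section Gronwall

/-- A discrete Gronwall inequality with a dissipation term. -/
theorem discrete_gronwall {X I : ℕ → ℝ≥0∞} {α : ℝ≥0∞} {N : ℕ}
    (h : ∀ n < N, X (n + 1) + I n ≤ X n + α * (X n + 1)) :
    ∀ n ≤ N, X n + ∑ k ∈ Finset.range n, I k + 1 ≤ (1 + α) ^ n * (X 0 + 1) := by
  intro n
  induction n with
  | zero => simp
  | succ n ih =>
    intro hn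
    have ih := ih (by omega)
    calc X (n + 1) + ∑ k ∈ Finset.range (n + 1), I k + 1
        = (X (n + 1) + I n) + (∑ k ∈ Finset.range n, I k + 1) := by
          rw [Finset.sum_range_succ]; ring
      _ ≤ (X n + α * (X n + 1)) + (∑ k ∈ Finset.range n, I k + 1) := by
          exact add_le_add (h n (by omega)) le_rfl
      _ = (X n + ∑ k ∈ Finset.range n, I k + 1) + α * (X n + 1) := by ring
      -- Adding the accumulated dissipation inside the growth term makes the recursion purely
      -- multiplicative.
      _ ≤ (X n + ∑ k ∈ Finset.range n, I k + 1) +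
            α * (X n + ∑ k ∈ Finset.range n, I k + 1) := by
          gcongr; exact le_self_add
      _ = (1 + α) * (X n + ∑ k ∈ Finset.range n, I k + 1) := by ring
      _ ≤ (1 + α) * ((1 + α) ^ n * (X 0 + 1)) := by gcongr
      _ = (1 + α) ^ (n + 1) * (X 0 + 1) := by ring

theorem one_add_ofReal_pow_le {a : ℝ} (ha : 0 ≤ a) {N n : ℕ} (hn : n ≤ N) :
    (1 + ENNReal.ofReal a) ^ n ≤ ENNReal.ofReal (Real.exp (N * a)) := by
  calc (1 + ENNReal.ofReal a) ^ n ≤ (1 + ENNReal.ofReal a) ^ N :=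
        pow_le_pow_right₀ le_self_add hn
    _ = ENNReal.ofReal ((1 + a) ^ N) := by
        rw [ENNReal.ofReal_pow (by positivity), ENNReal.ofReal_add zero_le_one ha,
          ENNReal.ofReal_one]
    _ ≤ ENNReal.ofReal (Real.exp (N * a)) := by
        refine ENNReal.ofReal_le_ofReal ?_
        rw [Real.exp_nat_mul]
        exact pow_le_pow_left₀ (by positivity) (by linarith [Real.add_one_le_exp a]) N

end Gronwall

/-! ### The energy inequality for one step of the scheme. -/

section Stability

variable {d q : ℕ} {L : ℝ} {T : ℝ≥0} {c : ℝ} {Ω : Type*} {mΩ : MeasurableSpace Ω} {P : Measure Ω}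
  {ℱ : Filtration ℝ≥0 mΩ} {W : ℝ≥0 → Ω → ℝ} {G : L2 d L → L2 d L}
  {DG : L2 d L → L2 d L →L[ℝ] L2 d L} {u₀ : Ω → L2 d L} {𝒯 : Triangulation d L} {N : ℕ}
  {u : ℕ → Ω → 𝒯.Vh}

/-- The energy dissipated in one time step of size `τ` from `y` to `z`. -/
noncomputable def dissipation (q : ℕ) (δ τ : ℝ) (y z : 𝒯.Vh) : ℝ :=
  1 / 2 * ‖𝒯.toL2 z - 𝒯.toL2 y‖ ^ 2 +
    2 * (τ * gip L (z : E d → ℝ) (z : E d → ℝ) + τ * (δ * ∫ x in cube d L, (z : E d → ℝ) x ^ (q + 1)))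

theorem dissipation_nonneg (hq : Odd q) {δ τ : ℝ} (hδ : 0 ≤ δ) (hτ : 0 ≤ τ) (y z : 𝒯.Vh) :
    0 ≤ dissipation q δ τ y z := by
  have h1 := Triangulation.gip_self_nonneg (L := L) (z : E d → ℝ)
  have h2 := Triangulation.setIntegral_pow_nonneg (L := L) hq (z : E d → ℝ)
  unfold dissipation
  positivity

/-- The dissipated energy controls the norms of the stability estimate. -/
theorem lpNorm_le_dissipation (hq : Odd q) {δ : ℝ} {τ : ℝ≥0} (hδ : 0 < δ) (y z : 𝒯.Vh) :
    lpNorm L 2 (z - y : E d → ℝ) ^ 2 + (τ : ℝ≥0∞) * lpNorm L 2 (gradient (z : E d → ℝ)) ^ 2 +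
      (τ : ℝ≥0∞) / 2 * lpNorm L (q + 1) (z : E d → ℝ) ^ (q + 1) ≤
    ENNReal.ofReal (2 + δ⁻¹) * ENNReal.ofReal (dissipation q δ τ y z) := by
  have h1 := Triangulation.gip_self_nonneg (L := L) (z : E d → ℝ)
  have h2 := Triangulation.setIntegral_pow_nonneg (L := L) hq (z : E d → ℝ)
  have hτ : (0 : ℝ) ≤ τ := τ.2
  have hs := sq_nonneg ‖𝒯.toL2 z - 𝒯.toL2 y‖
  have e1 : lpNorm L 2 (z - y : E d → ℝ) ^ 2 = ENNReal.ofReal (‖𝒯.toL2 z - 𝒯.toL2 y‖ ^ 2) :=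
    𝒯.lpNorm_two_sq (z - y)
  have e2 : (τ : ℝ≥0∞) / 2 = ENNReal.ofReal (τ / 2) := by
    rw [ENNReal.ofReal_div_of_pos two_pos, ENNReal.ofReal_coe_nnreal, ENNReal.ofReal_ofNat]
  rw [e1, e2, 𝒯.lpNorm_gradient_sq, 𝒯.lpNorm_pow hq, ← ENNReal.ofReal_coe_nnreal,
    ← ENNReal.ofReal_mul hτ, ← ENNReal.ofReal_mul (by positivity),
    ← ENNReal.ofReal_add (by positivity) (by positivity),
    ← ENNReal.ofReal_add (by positivity) (by positivity),
    ← ENNReal.ofReal_mul (by positivity)]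
  refine ENNReal.ofReal_le_ofReal ?_
  unfold dissipation
  -- In the factor `2 + δ⁻¹`, the 2 restores the halved increment, and `δ⁻¹` cancels the `δ` in
  -- front of the integral of `z ^ (q + 1)`.
  have hδ' : 0 < δ⁻¹ := inv_pos.2 hδ
  have hδδ : δ⁻¹ * δ = 1 := inv_mul_cancel₀ hδ.ne'
  generalize gip L (z : E d → ℝ) (z : E d → ℝ) = g at *
  generalize ∫ x in cube d L, (z : E d → ℝ) x ^ (q + 1) = p at *
  generalize ‖𝒯.toL2 z - 𝒯.toL2 y‖ ^ 2 = s at *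
  have hs' : 0 ≤ δ⁻¹ * s := mul_nonneg hδ'.le hs
  have hg' : 0 ≤ (3 + 2 * δ⁻¹) * (τ * g) := by positivity
  have hp' : 0 ≤ (4 * δ + 3 / 2) * (τ * p) := by positivity
  linear_combination (1 / 2) * hs' + hg' + hp' - 2 * τ * p * hδδ

theorem lintegral_step_le [IsProbabilityMeasure P] (hq : Odd q) (hq3 : 3 ≤ q) {γ : ℝ} (hγ0 : 0 < γ)
    (hγ : ∀ u : Fin (d + 1) → ℝ,
      γ * ∑ i, u i ^ (q + 1) ≤ ∑ i, u i ^ (q + 1) + (∑ i, u i ^ q) * ∑ i, u i)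
    (hW : IsWienerProcess P ℱ W) (hG : NoiseAssumptions G DG c)
    (hu : IsDiscreteSolution 𝒯 q T N P ℱ W G DG u₀ u) {n : ℕ} (hn : n < N) {δ K : ℝ}
    (hδ : δ = γ / (2 * (d + 2))) (hK : K = (1 + δ⁻¹) * volume.real (cube d L)) :
    ∫⁻ ω, ENNReal.ofReal (‖𝒯.toL2 (u (n + 1) ω)‖ ^ 2) ∂P +
        ∫⁻ ω, ENNReal.ofReal (dissipation q δ (T / N : ℝ≥0) (u n ω) (u (n + 1) ω)) ∂P ≤
      ∫⁻ ω, ENNReal.ofReal (‖𝒯.toL2 (u n ω)‖ ^ 2) ∂P +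
        ENNReal.ofReal ((T / N : ℝ≥0) * growthConst c T K) *
          (∫⁻ ω, ENNReal.ofReal (‖𝒯.toL2 (u n ω)‖ ^ 2) ∂P + 1) := by
  have hδ0 : 0 < δ := by rw [hδ]; positivity
  have hK0 : 0 ≤ K := by rw [hK]; positivity
  set τ : ℝ≥0 := T / N with hτ
  have hN : 1 ≤ N := by omega
  have hτT : (τ : ℝ) ≤ T := by
    rw [hτ, NNReal.coe_le_coe]
    exact div_le_self (by simp) (by exact_mod_cast hN)
  have hτr : (τ : ℝ) = (T : ℝ) / (N : ℝ) := by rw [hτ]; push_cast; rfl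
  have hle : (n : ℝ≥0) * τ ≤ ((n : ℝ≥0) + 1) * τ := by gcongr; simp
  set B : Ω → ℝ := W (((n : ℝ≥0) + 1) * τ) - W ((n : ℝ≥0) * τ) with hBd
  have hB : HasLaw B (gaussianReal 0 τ) P := by
    have h := hW.brownian.toIsPreBrownianReal.hasLaw_sub (((n : ℝ≥0) + 1) * τ) ((n : ℝ≥0) * τ)
    convert! h using 2
    rw [← NNReal.coe_inj, coe_nndist, Real.dist_eq]
    change (τ : ℝ) = |((((n : ℝ≥0) + 1) * τ : ℝ≥0) : ℝ) - (((n : ℝ≥0) * τ : ℝ≥0) : ℝ)|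
    push_cast
    rw [← sub_mul, add_sub_cancel_left, one_mul]
    exact (abs_of_nonneg τ.2).symm
  have hind := hW.indep _ _ hle
  have hY : StronglyMeasurable[ℱ ((n : ℝ≥0) * τ)] fun ω => 𝒯.toL2 (u n ω) :=
    𝒯.stronglyMeasurable_toL2 (hu.adapted n hn.le)
  set R : Ω → ℝ := fun ω => ‖𝒯.toL2 (u n ω)‖ ^ 2 + 2 * (τ * K) +
      2 * (⟪G (𝒯.toL2 (u n ω)), 𝒯.toL2 (u n ω)⟫ * B ω) +
      ⟪DG (𝒯.toL2 (u n ω)) (G (𝒯.toL2 (u n ω))), 𝒯.toL2 (u n ω)⟫ * (B ω ^ 2 - τ) +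
      4 * (‖G (𝒯.toL2 (u n ω))‖ ^ 2 * B ω ^ 2) +
      ‖DG (𝒯.toL2 (u n ω)) (G (𝒯.toL2 (u n ω)))‖ ^ 2 * (B ω ^ 2 - τ) ^ 2 with hR
  have hpath : ∀ᵐ ω ∂P, ‖𝒯.toL2 (u (n + 1) ω)‖ ^ 2 +
      dissipation q δ τ (u n ω) (u (n + 1) ω) ≤ R ω := by
    filter_upwards [hu.step n hn] with ω hω
    -- The exceptional null set does not depend on the test function, so the random function
    -- `u^{n+1}` itself may be used.
    have h := hω (u (n + 1) ω)
    simp only [← hτ, ← hτr] at h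
    have h1 := 𝒯.ip_interp_le_const hq hq3 hγ0 hγ (u (n + 1) ω)
    rw [← hδ, ← hK] at h1
    have h2 := mul_le_mul_of_nonneg_left h1 τ.2
    have e1 : ip L ((u (n + 1) ω : E d → ℝ) - (u n ω : E d → ℝ)) (u (n + 1) ω : E d → ℝ) =
        ⟪𝒯.toL2 (u (n + 1) ω) - 𝒯.toL2 (u n ω), 𝒯.toL2 (u (n + 1) ω)⟫ :=
      𝒯.ip_Vh_eq_inner (u (n + 1) ω - u n ω) (u (n + 1) ω)
    rw [e1, 𝒯.ip_eq_inner, 𝒯.ip_eq_inner] at h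
    have h3 := energy_le (y := 𝒯.toL2 (u n ω)) (z := 𝒯.toL2 (u (n + 1) ω))
      (g := G (𝒯.toL2 (u n ω))) (k := DG (𝒯.toL2 (u n ω)) (G (𝒯.toL2 (u n ω))))
      (B := B ω) (r := B ω ^ 2 - τ) (K := τ * K)
      (A := τ * gip L (u (n + 1) ω : E d → ℝ) (u (n + 1) ω : E d → ℝ) +
        τ * (δ * ∫ x in cube d L, (u (n + 1) ω : E d → ℝ) x ^ (q + 1)))
      (by
        have hBω : B ω = W (((n : ℝ≥0) + 1) * τ) ω - W ((n : ℝ≥0) * τ) ω := rfl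
        rw [hBω]
        change (τ : ℝ) * _ ≤ (τ : ℝ) * _ at h2
        linarith)
    rw [hR, dissipation]
    linarith
  have hnn := fun ω => dissipation_nonneg (𝒯 := 𝒯) (τ := (τ : ℝ)) hq hδ0.le τ.2 (u n ω) (u (n + 1) ω)
  have hR0 : 0 ≤ᵐ[P] R := by
    filter_upwards [hpath] with ω hω
    exact (add_nonneg (sq_nonneg _) (hnn ω)).trans hω
  refine le_trans ?_ (lintegral_energy_le (ℱ.le _) hG hY hB hind hK0 hτT hR hR0)
  -- Superadditivity of the lower integral suffices here, so measurability of the dissipation is not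
  -- required.
  refine (le_lintegral_add _ _).trans (lintegral_mono_ae ?_)
  filter_upwards [hpath] with ω hω
  rw [← ENNReal.ofReal_add (by exact sq_nonneg _) (hnn ω)]
  exact ENNReal.ofReal_le_ofReal hω

/-- Testing the projection with itself and applying Cauchy-Schwarz shows that it does not increase
the norm. -/
theorem lintegral_initial_le (hu : IsDiscreteSolution 𝒯 q T N P ℱ W G DG u₀ u) :
    ∫⁻ ω, ENNReal.ofReal (‖𝒯.toL2 (u 0 ω)‖ ^ 2) ∂P ≤ ∫⁻ ω, ‖u₀ ω‖ₑ ^ 2 ∂P := by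
  refine lintegral_mono_ae ?_
  filter_upwards [hu.initial] with ω hω
  have h := hω (u 0 ω)
  rw [𝒯.ip_Vh_eq_inner, 𝒯.ip_eq_inner, real_inner_self_eq_norm_sq] at h
  have h1 : ‖𝒯.toL2 (u 0 ω)‖ ≤ ‖u₀ ω‖ := by
    have h2 := real_inner_le_norm (u₀ ω) (𝒯.toL2 (u 0 ω))
    rcases (norm_nonneg (𝒯.toL2 (u 0 ω))).eq_or_lt with h0 | h0
    · rw [← h0]; exact norm_nonneg _
    · refine le_of_mul_le_mul_right ?_ h0
      rw [← pow_two, h]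
      exact h2
  rw [ENNReal.ofReal_pow (norm_nonneg _), ofReal_norm]
  gcongr
  exact enorm_le_iff_norm_le.2 h1

end Stability

end StochFEM

/-! ### The stability estimate. -/

theorem theorem4p3 (d q : ℕ) (hdq : (d = 2 ∧ Odd q ∧ 3 ≤ q) ∨ (d = 3 ∧ (q = 3 ∨ q = 5)))
    (L : ℝ) (hL : 0 < L) (T : ℝ≥0) (hT : 0 < T) (c M : ℝ) :
    ∃ C : ℝ, ∀ (Ω : Type*) (mΩ : MeasurableSpace Ω) (P : Measure Ω) (_ : IsProbabilityMeasure P)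
      (ℱ : Filtration ℝ≥0 mΩ) (W : ℝ≥0 → Ω → ℝ) (_ : StochFEM.IsWienerProcess P ℱ W)
      (G : StochFEM.L2 d L → StochFEM.L2 d L)
      (DG : StochFEM.L2 d L → StochFEM.L2 d L →L[ℝ] StochFEM.L2 d L)
      (_ : StochFEM.NoiseAssumptions G DG c)
      (u₀ : Ω → StochFEM.L2 d L) (_ : StronglyMeasurable[ℱ 0] u₀)
      (_ : ∫⁻ ω, ‖u₀ ω‖ₑ ^ 2 ∂P ≤ ENNReal.ofReal M)
      (𝒯 : StochFEM.Triangulation d L) (_ : 𝒯.MeshCondition) (N : ℕ) (_ : 0 < N)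
      (u : ℕ → Ω → 𝒯.Vh) (_ : StochFEM.IsDiscreteSolution 𝒯 q T N P ℱ W G DG u₀ u),
      (⨆ n ∈ Finset.range (N + 1), ∫⁻ ω, StochFEM.lpNorm L 2 (u n ω : StochFEM.E d → ℝ) ^ 2 ∂P)
        + ∑ n ∈ Finset.range N,
            ∫⁻ ω, StochFEM.lpNorm L 2 (u (n + 1) ω - u n ω : StochFEM.E d → ℝ) ^ 2 ∂P
        + ((T / N : ℝ≥0) : ℝ≥0∞) * ∑ n ∈ Finset.range N,
            ∫⁻ ω, StochFEM.lpNorm L 2 (gradient (u (n + 1) ω : StochFEM.E d → ℝ)) ^ 2 ∂P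
        + ((T / N : ℝ≥0) : ℝ≥0∞) / 2 * ∑ n ∈ Finset.range N,
            ∫⁻ ω, StochFEM.lpNorm L (q + 1) (u (n + 1) ω : StochFEM.E d → ℝ) ^ (q + 1) ∂P
      ≤ ENNReal.ofReal C := by
  have hq : Odd q ∧ 3 ≤ q := by
    rcases hdq with ⟨-, h⟩ | ⟨-, rfl | rfl⟩
    · exact h
    · exact ⟨by decide, le_rfl⟩
    · exact ⟨by decide, by norm_num⟩
  obtain ⟨γ, hγ0, hγ⟩ := StochFEM.exists_coercive hdq
  obtain ⟨δ, hδ⟩ : ∃ δ : ℝ, δ = γ / (2 * (d + 2)) := ⟨_, rfl⟩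
  obtain ⟨K, hK⟩ : ∃ K : ℝ, K = (1 + δ⁻¹) * volume.real (StochFEM.cube d L) := ⟨_, rfl⟩
  have hδ0 : 0 < δ := by rw [hδ]; positivity
  have hK0 : 0 ≤ K := by rw [hK]; positivity
  have hA := StochFEM.growthConst_nonneg (c := c) T.2 hK0
  -- The summand 1 pays for the supremum and `2 + δ⁻¹` for the three sums. The maximum with 0 covers
  -- negative `M`, for which `ENNReal.ofReal M` is 0.
  refine ⟨(1 + (2 + δ⁻¹)) * (Real.exp (T * StochFEM.growthConst c T K) * (max M 0 + 1)), ?_⟩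
  intro Ω mΩ P _ ℱ W hW G DG hG u₀ _ hM 𝒯 _ N hN u hu
  set X : ℕ → ℝ≥0∞ := fun n => ∫⁻ ω, ENNReal.ofReal (‖𝒯.toL2 (u n ω)‖ ^ 2) ∂P with hX
  set I : ℕ → ℝ≥0∞ := fun n => ∫⁻ ω, ENNReal.ofReal
    (StochFEM.dissipation q δ (T / N : ℝ≥0) (u n ω) (u (n + 1) ω)) ∂P with hI
  set Q : ℝ≥0∞ := ENNReal.ofReal (Real.exp (T * StochFEM.growthConst c T K) * (max M 0 + 1))
    with hQ
  have hX0 : X 0 + 1 ≤ ENNReal.ofReal (max M 0 + 1) := by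
    rw [ENNReal.ofReal_add (le_max_right _ _) zero_le_one, ENNReal.ofReal_one]
    gcongr
    exact ((StochFEM.lintegral_initial_le hu).trans hM).trans
      (ENNReal.ofReal_le_ofReal (le_max_left _ _))
  -- `N` steps of length `T / N` make the Gronwall exponent independent of `N`.
  have hτN : (N : ℝ) * (((T / N : ℝ≥0) : ℝ) * StochFEM.growthConst c T K) =
      T * StochFEM.growthConst c T K := by
    push_cast
    have : (N : ℝ) ≠ 0 := by positivity
    field_simp
  have hgron : ∀ n ≤ N, X n + ∑ k ∈ Finset.range n, I k + 1 ≤ Q := fun n hn => by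
    refine (StochFEM.discrete_gronwall (X := X) (I := I) (N := N) (fun n hn =>
      StochFEM.lintegral_step_le hq.1 hq.2 hγ0 hγ hW hG hu hn hδ hK) n hn).trans ?_
    rw [hQ, ENNReal.ofReal_mul (Real.exp_nonneg _), ← hτN]
    exact mul_le_mul' (StochFEM.one_add_ofReal_pow_le (by positivity) hn) hX0
  have hsup : (⨆ n ∈ Finset.range (N + 1),
      ∫⁻ ω, StochFEM.lpNorm L 2 (u n ω : StochFEM.E d → ℝ) ^ 2 ∂P) ≤ Q := by
    refine iSup₂_le fun n hn => ?_
    simp only [𝒯.lpNorm_two_sq]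
    refine le_trans ?_ (hgron n (by simpa [Nat.lt_succ_iff] using hn))
    rw [add_assoc]
    exact le_self_add
  have hsum : ∑ n ∈ Finset.range N,
        ∫⁻ ω, StochFEM.lpNorm L 2 (u (n + 1) ω - u n ω : StochFEM.E d → ℝ) ^ 2 ∂P
      + ((T / N : ℝ≥0) : ℝ≥0∞) * ∑ n ∈ Finset.range N,
          ∫⁻ ω, StochFEM.lpNorm L 2 (gradient (u (n + 1) ω : StochFEM.E d → ℝ)) ^ 2 ∂P
      + ((T / N : ℝ≥0) : ℝ≥0∞) / 2 * ∑ n ∈ Finset.range N,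
          ∫⁻ ω, StochFEM.lpNorm L (q + 1) (u (n + 1) ω : StochFEM.E d → ℝ) ^ (q + 1) ∂P
      ≤ ENNReal.ofReal (2 + δ⁻¹) * Q := by
    have hI' : ENNReal.ofReal (2 + δ⁻¹) * ∑ n ∈ Finset.range N, I n ≤
        ENNReal.ofReal (2 + δ⁻¹) * Q := by
      gcongr
      refine le_trans ?_ (hgron N le_rfl)
      exact le_add_self.trans le_self_add
    refine le_trans ?_ hI'
    rw [Finset.mul_sum, Finset.mul_sum, Finset.mul_sum, ← Finset.sum_add_distrib,
      ← Finset.sum_add_distrib]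
    refine Finset.sum_le_sum fun n _ => ?_
    rw [hI, ← lintegral_const_mul' _ _ ENNReal.ofReal_ne_top,
      ← lintegral_const_mul' _ _ ENNReal.coe_ne_top,
      ← lintegral_const_mul' _ _ (ENNReal.div_ne_top ENNReal.coe_ne_top two_ne_zero)]
    refine (add_le_add_left (le_lintegral_add _ _) _).trans ((le_lintegral_add _ _).trans ?_)
    exact lintegral_mono fun ω => StochFEM.lpNorm_le_dissipation hq.1 hδ0 (u n ω) (u (n + 1) ω)
  rw [add_assoc, add_assoc, ← add_assoc (∑ n ∈ Finset.range N, _)]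
  refine (add_le_add hsup hsum).trans_eq ?_
  rw [ENNReal.ofReal_mul (by positivity), ENNReal.ofReal_add zero_le_one (by positivity),
    ENNReal.ofReal_one, add_mul, one_mul]
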